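/- Let $d\ge 1$, $\lambda\in\mathbb{R}\setminus\{0\}$ and $\sigma>0$. Assume that either $\sigma$ is an integer, or there exists an integer $r$ with $2\sigma\ge r>d/2$. Let $P:\mathbb{R}^d\to\mathbb{R}$ be either linear, $P(\xi)=c\cdot\xi$ for some $c\in\mathbb{R}^d$, or constant. Consider, for $(t,x)\in\mathbb{R}_+\times\mathbb{R}^d$, the Cauchy problem $$ i\partial_t u+P(D)u=\lambda|u|^{2\sigma}u,\qquad u_{|t=0}=u_0,\qquad D=-i\nabla_x. \tag{1}$$ A solution of (1) in $C(\mathbb{R}_+;\mathcal{D}'(\mathbb{R}^d))$ is a $u$ in this space with $u(0)=u_0$ which on $(0,\infty)\times\mathbb{R}^d$ is given by a locally integrable function such that $|u|^{2\sigma}u$ is locally integrable and the equation in (1) holds in $\mathcal{D}'((0,\infty)\times\mathbb{R}^d)$. Then for every $\delta>0$ there exists $u_0\in H^{d/2}(\mathbb{R}^d)$ with $\|u_0\|_{H^{d/2}(\mathbb{R}^d)}\le\delta$ such that (1) has a unique solution $u\in C(\mathbb{R}_+;\mathcal{D}'(\mathbb{R}^d))$, and $u(t,\cdot)\notin H^{d/2}(\mathbb{R}^d)$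 for every $t>0$. -/

import Mathlib

open MeasureTheory Set TopologicalSpace Distributions FourierTransform
open scoped NNReal ENNReal SchwartzMap

noncomputable section

namespace ModifiedNLS

/-- The space variable `x` lives in `ℝ^d` with its Euclidean structure. -/
abbrev Space (d : ℕ) : Type := EuclideanSpace ℝ (Fin d)

variable {d : ℕ}

/-- The space `𝒟'(ℝ^d)` of complex-valued distributions on the whole of `ℝ^d`. -/
abbrev Distr (d : ℕ) : Type := 𝓓'((⊤ : Opens (Space d)), ℂ)

/-- A real-valued test function, seen as a complex-valued Schwartz function. -/
def testToSchwartz (φ : 𝓓((⊤ : Opens (Space d)), ℝ)) : 𝓢(Space d, ℂ) :=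
  HasCompactSupport.toSchwartzMap (f := fun x => ((φ x : ℝ) : ℂ))
    (φ.hasCompactSupport.comp_left (g := fun r : ℝ => (r : ℂ)) Complex.ofReal_zero)
    (Complex.ofRealCLM.contDiff.comp φ.contDiff)

/-- The tempered distribution `T` restricts to the distribution `u`. -/
def RestrictsTo (T : 𝓢'(Space d, ℂ)) (u : Distr d) : Prop :=
  ∀ φ : 𝓓((⊤ : Opens (Space d)), ℝ), u φ = T (testToSchwartz φ)

/-- `u ∈ H^s(ℝ^d)`: the distribution `u` is (the restriction of) a tempered distribution
in the `L²`-based Sobolev space of order `s`. -/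
def MemH (s : ℝ) (u : Distr d) : Prop :=
  ∃ T : 𝓢'(Space d, ℂ), RestrictsTo T u ∧ TemperedDistribution.MemSobolev s 2 T

/-- The norm `‖u‖_{H^s}`, the `L²` norm of the Bessel potential of order `s` of `u`; it is `∞`
if `u ∉ H^s`. -/
def normH (s : ℝ) (u : Distr d) : ℝ≥0∞ :=
  ⨅ (T : 𝓢'(Space d, ℂ)) (_ : RestrictsTo T u) (f : Lp ℂ 2 (volume : Measure (Space d)))
    (_ : TemperedDistribution.besselPotential (Space d) ℂ s T = (f : 𝓢'(Space d, ℂ))), ‖f‖ₑ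

/-- The Fourier multiplier `P(-D)`, `D = -i∇`, acting on a function on `ℝ^d`. It is the transpose
of `P(D)` for the bilinear pairing `∫ f g`. With the Fourier transform `∫ e^{-2iπ x·ξ} f(x) dx`,
the operator `D` has symbol `2πξ`. -/
def multTranspose (P : Space d → ℝ) (φ : Space d → ℂ) : Space d → ℂ :=
  𝓕⁻ (fun ξ : Space d => ((P (-((2 * Real.pi) • ξ)) : ℝ) : ℂ) * 𝓕 φ ξ)

/-- The nonlinearity `|z|^{2σ} z`. -/
def nonlin (σ : ℝ) (z : ℂ) : ℂ := ((‖z‖ ^ (2 * σ) : ℝ) : ℂ) * z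

/-- The open half space-time `(0,∞) × ℝ^d`. -/
def spaceTime (d : ℕ) : Opens (ℝ × Space d) :=
  ⟨Ioi 0 ×ˢ univ, isOpen_Ioi.prod isOpen_univ⟩

/-- `u ∈ C(ℝ₊; 𝒟'(ℝ^d))` solves `i ∂ₜu + P(D) u = lam |u|^{2σ} u`, `u(0) = u₀`.
That is: on `(0,∞) × ℝ^d`, `u` is given by a locally integrable function `U` such that
`|U|^{2σ} U` is locally integrable, and the equation holds in `𝒟'((0,∞) × ℝ^d)`. -/
structure IsSolution (P : Space d → ℝ) (lam σ : ℝ) (u₀ : Distr d) (u : C(ℝ≥0, Distr d)) :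
    Prop where
  initial : u 0 = u₀
  equation : ∃ U : ℝ × Space d → ℂ,
    LocallyIntegrableOn U (spaceTime d) ∧
    LocallyIntegrableOn (fun p => nonlin σ (U p)) (spaceTime d) ∧
    (∀ᵐ t : ℝ, 0 < t → LocallyIntegrable (fun x => U (t, x)) ∧
      ∀ φ : 𝓓((⊤ : Opens (Space d)), ℝ),
        u t.toNNReal φ = ∫ x, ((φ x : ℝ) : ℂ) * U (t, x)) ∧
    ∀ Φ : 𝓓(spaceTime d, ℂ),
      ∫ p in (spaceTime d : Set (ℝ × Space d)),
        (-(Complex.I * U p * deriv (fun s => Φ (s, p.2)) p.1)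
          + U p * multTranspose P (fun x => Φ (p.1, x)) p.2) =
      ∫ p in (spaceTime d : Set (ℝ × Space d)), (lam : ℂ) * nonlin σ (U p) * Φ p

end ModifiedNLS

end

noncomputable section

namespace ModifiedNLS

open Filter
open scoped ContDiff Topology

variable {d : ℕ}

/-! ### The multiplier `P(-D)` for an affine symbol -/

/-! For an affine symbol `P ξ = c · ξ + a` the operator `P(D)` is transport plus a phase, so there
is no dispersion. Writing `u(t, x) = e^{iat} w(t, x + tc)` turns the equation into `i ∂ₜ w = lam
|w|^{2σ} w`, an ordinary differential equation at each point. It preserves `|w|`, so its solution is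
`flow`: `w = e^{-i lam t |v|^{2σ}} v`. The translation and the constant phase do not affect
membership in `H^{d/2}`. Everything therefore depends on how multiplication by `e^{-i lam t
|v|^{2σ}}` acts on `H^{d/2}`, which just fails to embed in `L^∞`.

Datum. The average of `N` dyadic dilates of a bump, times `h`, equals `h` near its centre but has
`H^{d/2}` norm of order `h / √N`, because the dilates are almost orthogonal
(`exists_norm_inner_bessel_dilate_le`, `norm_sum_range_sq_le`). So arbitrarily high plateaus cost
arbitrarily little. On each plateau sits a small bump of height `a` at a finer scale. By
`exists_height`, `h` and `a` can be chosen so that the phase gap `D = (h + a)^{2σ} - h^{2σ}` is at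
most `1 / K` while `h D ≥ K`. The datum is a sum of such blocks with disjoint supports, with `K → ∞`
and geometrically decreasing norms (`exists_initial_datum`).

Loss of regularity. At time `t > 0` the solution takes two values on neighbouring balls of radius
comparable to `M⁻¹`, and these values differ by at least `(2 / π) |lam| t K - 1`
(`le_norm_flow_sub_flow`). The difference is detected by pairing with a dipole of two opposite unit
masses at scale `M⁻¹`. The Fourier transform of a dipole vanishes at the origin, so dipoles are
bounded in `H^{-d/2}` uniformly in `M` (`exists_norm_apply_dilate_le`). An element of `H^{d/2}`
would thus have bounded pairings with dipoles, a contradiction for large `K` (`not_memH_flow`).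

Uniqueness. A weak solution, straightened along characteristics, satisfies for almost every `y` a
weak ordinary differential equation in `t` (`ae_slice_weak`). It is therefore `flow` applied to some
`A y` (`exists_ae_eq_flow_of_weak_solution`, `exists_profile`), and continuity at `t = 0` in the
sense of distributions forces `A = v` almost everywhere (`eq_evolutionCurve_of_isSolution`). -/

theorem multTranspose_affine {P : Space d → ℝ} {c : Space d} {a : ℝ}
    (hP : ∀ ξ, P ξ = inner ℝ c ξ + a) (φ : 𝓢(Space d, ℂ)) (x : Space d) :
    multTranspose P φ x = Complex.I * fderiv ℝ φ x c + a * φ x := by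
  have hsymb : (fun ξ : Space d => ((P (-((2 * Real.pi) • ξ)) : ℝ) : ℂ) * 𝓕 (φ : Space d → ℂ) ξ) =
      ((Complex.I • 𝓕 (LineDeriv.lineDerivOp c φ) + (a : ℂ) • 𝓕 φ : 𝓢(Space d, ℂ)) :
        Space d → ℂ) := by
    ext ξ
    rw [SchwartzMap.fourier_lineDerivOp_eq, hP]
    simp only [_root_.add_apply, _root_.smul_apply, smul_eq_mul]
    rw [SchwartzMap.smulLeftCLM_apply_apply (by fun_prop), SchwartzMap.fourier_coe]
    simp only [inner_neg_right, inner_smul_right, real_inner_comm ξ c]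
    push_cast
    simp only [Complex.real_smul]
    linear_combination (-2 * Real.pi * (inner ℝ ξ c : ℝ) * 𝓕 (φ : Space d → ℂ) ξ) * Complex.I_sq
  rw [multTranspose, hsymb, ← SchwartzMap.fourierInv_coe]
  simp only [FourierTransform.fourierInv_add, FourierTransform.fourierInv_smul,
    FourierTransform.fourierInv_fourier_eq]
  simp [SchwartzMap.lineDerivOp_apply_eq_fderiv]

/-! ### Bessel potentials of Schwartz functions -/

/-- The Bessel potential of order `s` of a Schwartz function. -/
def bessel (s : ℝ) : 𝓢(Space d, ℂ) →L[ℂ] 𝓢(Space d, ℂ) :=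
  SchwartzMap.fourierMultiplierCLM ℂ (fun x : Space d ↦ (((1 + ‖x‖ ^ 2) ^ (s / 2) : ℝ) : ℂ))

theorem fourier_bessel_apply (s : ℝ) (f : 𝓢(Space d, ℂ)) (ξ : Space d) :
    𝓕 (bessel s f) ξ = (((1 + ‖ξ‖ ^ 2) ^ (s / 2) : ℝ) : ℂ) * 𝓕 f ξ := by
  rw [bessel, SchwartzMap.fourierMultiplierCLM_apply, FourierTransform.fourier_fourierInv_eq,
    SchwartzMap.smulLeftCLM_apply_apply (by fun_prop), smul_eq_mul]

theorem besselPotential_coe (s : ℝ) (f : 𝓢(Space d, ℂ)) :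
    TemperedDistribution.besselPotential (Space d) ℂ s (f : 𝓢'(Space d, ℂ)) =
      (((bessel s f).toLp 2 : Lp ℂ 2 (volume : Measure (Space d))) : 𝓢'(Space d, ℂ)) := by
  rw [TemperedDistribution.besselPotential, Lp.toTemperedDistribution_toLp_eq,
    TemperedDistribution.fourierMultiplierCLM_toTemperedDistributionCLM_eq (by fun_prop)]
  rfl

theorem inner_bessel (s : ℝ) (f g : 𝓢(Space d, ℂ)) :
    inner ℂ ((bessel s f).toLp 2 : Lp ℂ 2 (volume : Measure (Space d))) ((bessel s g).toLp 2) =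
      ∫ ξ : Space d, (((1 + ‖ξ‖ ^ 2) ^ s : ℝ) : ℂ) *
        (𝓕 g ξ * (starRingEnd ℂ) (𝓕 f ξ)) := by
  rw [← SchwartzMap.inner_fourier_toL2_eq]
  refine (SchwartzMap.inner_toL2_toL2_eq _ _ volume).trans ?_
  congr 1 with ξ
  rw [fourier_bessel_apply, fourier_bessel_apply]
  have : (1 + ‖ξ‖ ^ 2) ^ s = (1 + ‖ξ‖ ^ 2) ^ (s / 2) * (1 + ‖ξ‖ ^ 2) ^ (s / 2) := by
    rw [← Real.rpow_add (by positivity)]; ring_nf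
  rw [this]
  simp only [RCLike.inner_apply, map_mul, Complex.conj_ofReal]
  push_cast
  ring

theorem norm_bessel_sq (s : ℝ) (f : 𝓢(Space d, ℂ)) :
    ‖((bessel s f).toLp 2 : Lp ℂ 2 (volume : Measure (Space d)))‖ ^ 2 =
      ∫ ξ : Space d, (1 + ‖ξ‖ ^ 2) ^ s * ‖𝓕 f ξ‖ ^ 2 := by
  have h := inner_bessel s f f
  rw [inner_self_eq_norm_sq_to_K] at h
  apply Complex.ofReal_injective
  rw [← integral_complex_ofReal]
  push_cast at h ⊢
  rw [← Complex.coe_algebraMap] at h ⊢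
  refine h.trans (integral_congr_ae (.of_forall fun ξ => ?_))
  simp [Complex.mul_conj, Complex.normSq_eq_norm_sq]

/-! ### Dilations -/

/-- The function `x ↦ f (M (x - x₀))`. -/
def dilate (M : ℝˣ) (x₀ : Space d) (f : 𝓢(Space d, ℂ)) : 𝓢(Space d, ℂ) :=
  (SchwartzMap.compCLMOfContinuousLinearEquiv ℂ
    (ContinuousLinearEquiv.smulLeft (R₁ := ℝ) M) f).compSubConstCLM ℂ x₀

theorem dilate_apply (M : ℝˣ) (x₀ : Space d) (f : 𝓢(Space d, ℂ)) (x : Space d) :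
    dilate M x₀ f x = f ((M : ℝ) • (x - x₀)) := rfl

theorem fourier_dilate (M : ℝˣ) (hM : (0 : ℝ) < M) (x₀ : Space d) (f : 𝓢(Space d, ℂ))
    (ξ : Space d) :
    𝓕 (dilate M x₀ f) ξ =
      Real.fourierChar (-inner ℝ x₀ ξ) • ((((M : ℝ) ^ d)⁻¹ : ℝ) • 𝓕 f ((M : ℝ)⁻¹ • ξ)) := by
  have key : ∀ v : Space d, (Real.fourierChar (-inner ℝ (v + x₀) ξ)) • dilate M x₀ f (v + x₀) =
      (Real.fourierChar (-inner ℝ x₀ ξ) : ℂ) • (fun u : Space d =>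
        Real.fourierChar (-inner ℝ u ((M : ℝ)⁻¹ • ξ)) • f u) ((M : ℝ) • v) := by
    intro v
    simp only [dilate_apply, add_sub_cancel_right, inner_add_left, neg_add, inner_smul_left,
      inner_smul_right]
    rw [← Circle.smul_def, smul_smul, ← AddChar.map_add_eq_mul, add_comm]
    congr 3
    simp [hM.ne']
  rw [SchwartzMap.fourier_coe, Real.fourier_eq, SchwartzMap.fourier_coe, Real.fourier_eq,
    ← integral_add_right_eq_self _ x₀]
  simp_rw [key]
  rw [integral_smul, Circle.smul_def]
  congr 1
  refine (Measure.integral_comp_smul volume (fun u : Space d =>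
    Real.fourierChar (-inner ℝ u ((M : ℝ)⁻¹ • ξ)) • f u) (M : ℝ)).trans ?_
  simp [abs_of_pos hM]

theorem norm_fourier_dilate (M : ℝˣ) (hM : (0 : ℝ) < M) (x₀ : Space d) (f : 𝓢(Space d, ℂ))
    (ξ : Space d) :
    ‖𝓕 (dilate M x₀ f) ξ‖ = ((M : ℝ) ^ d)⁻¹ * ‖𝓕 f ((M : ℝ)⁻¹ • ξ)‖ := by
  rw [fourier_dilate M hM]
  simp [Circle.norm_smul, abs_of_pos hM]


/-! ### Almost orthogonality of dilations in the critical Sobolev space -/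

theorem integrable_weight_mul_fourier (s : ℝ) (f : 𝓢(Space d, ℂ)) :
    Integrable (fun ξ : Space d => (1 + ‖ξ‖ ^ 2) ^ s * ‖𝓕 f ξ‖) := by
  have h := (SchwartzMap.integrable (μ := volume) (SchwartzMap.smulLeftCLM ℂ
    (fun x : Space d ↦ (((1 + ‖x‖ ^ 2) ^ s : ℝ) : ℂ)) (𝓕 f))).norm
  refine h.congr (.of_forall fun ξ => ?_)
  have hw : Function.HasTemperateGrowth (fun x : Space d ↦ (((1 + ‖x‖ ^ 2) ^ s : ℝ) : ℂ)) := by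
    have := Function.hasTemperateGrowth_one_add_norm_sq_rpow (Space d) s
    fun_prop
  dsimp only
  rw [SchwartzMap.smulLeftCLM_apply_apply hw, smul_eq_mul, norm_mul, Complex.norm_real,
    Real.norm_of_nonneg (by positivity)]

/-- The space `H^{d/2}` is critical: dilation keeps the high-frequency part of the norm fixed. The
finer bump has a flat transform of size `M'⁻ᵈ` over the frequencies `|ξ| ≲ M` where the coarser one
lives, hence the gain `(M / M')^d`. -/
theorem exists_norm_inner_bessel_dilate_le (φ : 𝓢(Space d, ℂ)) :
    ∃ C : ℝ, 0 ≤ C ∧ ∀ M M' : ℝˣ, (1 : ℝ) ≤ M → (M : ℝ) ≤ M' → ∀ x₀ : Space d,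
      ‖inner ℂ ((bessel ((d : ℝ) / 2) (dilate M x₀ φ)).toLp 2 : Lp ℂ 2 (volume : Measure (Space d)))
        ((bessel ((d : ℝ) / 2) (dilate M' x₀ φ)).toLp 2)‖ ≤ C * ((M : ℝ) / M') ^ d := by
  set g : Space d → ℝ := fun ξ => (1 + ‖ξ‖ ^ 2) ^ ((d : ℝ) / 2) * ‖𝓕 φ ξ‖ with hg
  have hgi : Integrable g := integrable_weight_mul_fourier _ φ
  have hg0 : ∀ ξ, 0 ≤ g ξ := fun ξ => by positivity
  set S : ℝ := SchwartzMap.seminorm ℝ 0 0 (𝓕 φ) with hS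
  have hS0 : 0 ≤ S := apply_nonneg _ _
  refine ⟨S * ∫ ξ, g ξ, mul_nonneg hS0 (integral_nonneg hg0), fun M M' hM hMM' x₀ => ?_⟩
  have hM0 : (0 : ℝ) < M := by linarith
  have hM'0 : (0 : ℝ) < M' := by linarith
  rw [inner_bessel]
  have hbound : ∀ ξ : Space d, ‖(((1 + ‖ξ‖ ^ 2) ^ ((d : ℝ) / 2) : ℝ) : ℂ) *
      (𝓕 (dilate M' x₀ φ) ξ * (starRingEnd ℂ) (𝓕 (dilate M x₀ φ) ξ))‖ ≤
      S * ((M' : ℝ) ^ d)⁻¹ * g ((M : ℝ)⁻¹ • ξ) := by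
    intro ξ
    rw [norm_mul, norm_mul, RCLike.norm_conj, norm_fourier_dilate M hM0, norm_fourier_dilate M' hM'0,
      Complex.norm_real, Real.norm_of_nonneg (by positivity)]
    have h1 : ‖𝓕 φ ((M' : ℝ)⁻¹ • ξ)‖ ≤ S := SchwartzMap.norm_le_seminorm ℝ _ _
    -- `M ≥ 1` allows the inhomogeneous weight to be rescaled as if it were homogeneous.
    have h2 : (1 + ‖ξ‖ ^ 2) ^ ((d : ℝ) / 2) ≤
        (M : ℝ) ^ d * (1 + ‖(M : ℝ)⁻¹ • ξ‖ ^ 2) ^ ((d : ℝ) / 2) := by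
      have : (M : ℝ) ^ d = ((M : ℝ) ^ 2) ^ ((d : ℝ) / 2) := by
        rw [← Real.rpow_natCast_mul hM0.le, ← Real.rpow_natCast]
        congr 1; push_cast; ring
      rw [this, ← Real.mul_rpow (by positivity) (by positivity)]
      refine Real.rpow_le_rpow (by positivity) ?_ (by positivity)
      rw [norm_smul, norm_inv, Real.norm_of_nonneg hM0.le]
      have : (M : ℝ) ^ 2 * (1 + ((M : ℝ)⁻¹ * ‖ξ‖) ^ 2) = (M : ℝ) ^ 2 + ‖ξ‖ ^ 2 := by
        field_simp
      rw [this]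
      nlinarith
    calc _ ≤ ((M : ℝ) ^ d * (1 + ‖(M : ℝ)⁻¹ • ξ‖ ^ 2) ^ ((d : ℝ) / 2)) *
          (((M' : ℝ) ^ d)⁻¹ * S * (((M : ℝ) ^ d)⁻¹ * ‖𝓕 φ ((M : ℝ)⁻¹ • ξ)‖)) := by gcongr
      _ = _ := by rw [hg]; field_simp
  refine (norm_integral_le_of_norm_le ?_ (.of_forall hbound)).trans (le_of_eq ?_)
  · exact (hgi.comp_smul (inv_ne_zero hM0.ne')).const_mul _
  · rw [integral_const_mul, Measure.integral_comp_smul]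
    simp only [finrank_euclideanSpace, Fintype.card_fin, inv_pow, inv_inv, smul_eq_mul,
      abs_of_pos (pow_pos hM0 d), div_pow]
    field_simp

/-! ### Concentrating test functions are bounded in the dual Sobolev space -/

/-- In polar coordinates the Jacobian leaves a factor `1 / r`, absorbed by one power of `r` from the
square; the other factors give the decay `(1 + r²)⁻¹`. -/
theorem integrable_norm_sq_div (hd : 1 ≤ d) :
    Integrable (fun ξ : Space d => (‖ξ‖ ^ d)⁻¹ * (‖ξ‖ * (1 + ‖ξ‖ ^ 2)⁻¹) ^ 2) := by
  have : Nonempty (Fin d) := ⟨⟨0, hd⟩⟩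
  have key := integrable_fun_norm_addHaar (volume : Measure (Space d))
    (f := fun r : ℝ => (r ^ d)⁻¹ * (r * (1 + r ^ 2)⁻¹) ^ 2)
  rw [key, finrank_euclideanSpace, Fintype.card_fin]
  refine Integrable.mono' (g := fun r : ℝ => (1 + r ^ 2)⁻¹) integrable_inv_one_add_sq.integrableOn
    (by fun_prop) ?_
  refine (ae_restrict_iff' measurableSet_Ioi).2 (.of_forall fun r hr => ?_)
  have hr : 0 < r := hr
  obtain ⟨n, rfl⟩ : ∃ n, d = n + 1 := ⟨d - 1, by omega⟩
  rw [Real.norm_of_nonneg (by simp only [smul_eq_mul]; positivity)]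
  simp only [add_tsub_cancel_right, smul_eq_mul]
  have : r ^ n * ((r ^ (n + 1))⁻¹ * (r * (1 + r ^ 2)⁻¹) ^ 2) =
      (r * (1 + r ^ 2)⁻¹) * (1 + r ^ 2)⁻¹ := by
    field_simp
    ring
  rw [this]
  refine mul_le_of_le_one_left (by positivity) ?_
  rw [← div_eq_mul_inv, div_le_one (by positivity)]
  nlinarith [sq_nonneg (r - 1)]

/-- The weight is bounded by `|ξ|^{-d}`, for which the integral is invariant under `ξ ↦ ξ / M`. This
homogeneous weight is not integrable at the origin, which is why `𝓕 ψ` is required to vanish there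
to first order. -/
theorem exists_norm_bessel_neg_dilate_le (hd : 1 ≤ d) {ψ : 𝓢(Space d, ℂ)} {A : ℝ}
    (hψ : ∀ ξ, ‖𝓕 ψ ξ‖ ≤ A * (‖ξ‖ * (1 + ‖ξ‖ ^ 2)⁻¹)) :
    ∃ C : ℝ, ∀ M : ℝˣ, (0 : ℝ) < M → ∀ x₀ : Space d,
      ‖((bessel (-((d : ℝ) / 2)) ((M : ℝ) ^ d • dilate M x₀ ψ)).toLp 2 :
        Lp ℂ 2 (volume : Measure (Space d)))‖ ^ 2 ≤ C := by
  set k : Space d → ℝ := fun ξ => (‖ξ‖ ^ d)⁻¹ * (‖ξ‖ * (1 + ‖ξ‖ ^ 2)⁻¹) ^ 2 with hk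
  have hki : Integrable k := integrable_norm_sq_div hd
  refine ⟨A ^ 2 * ∫ ξ, k ξ, fun M hM x₀ => ?_⟩
  rw [norm_bessel_sq]
  have hbound : ∀ ξ : Space d, (1 + ‖ξ‖ ^ 2) ^ (-((d : ℝ) / 2)) *
      ‖𝓕 ((M : ℝ) ^ d • dilate M x₀ ψ) ξ‖ ^ 2 ≤
      A ^ 2 * ((M : ℝ) ^ d)⁻¹ * k ((M : ℝ)⁻¹ • ξ) := by
    intro ξ
    rw [FourierTransform.fourier_smul, _root_.smul_apply, norm_smul, norm_fourier_dilate M hM,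
      Real.norm_of_nonneg (by positivity), mul_inv_cancel_left₀ (by positivity)]
    rcases eq_or_ne ξ 0 with rfl | hξ
    · have := hψ 0
      simp only [norm_zero, zero_mul, mul_zero, norm_le_zero_iff] at this
      simp [this, hk]
    have hξ' : 0 < ‖ξ‖ := norm_pos_iff.2 hξ
    have h1 : (1 + ‖ξ‖ ^ 2) ^ (-((d : ℝ) / 2)) ≤ ((M : ℝ) ^ d)⁻¹ * (‖(M : ℝ)⁻¹ • ξ‖ ^ d)⁻¹ := by
      rw [← mul_inv, ← mul_pow, norm_smul, norm_inv, Real.norm_of_nonneg hM.le,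
        mul_inv_cancel_left₀ hM.ne', Real.rpow_neg (by positivity)]
      refine inv_anti₀ (by positivity) ?_
      have : ‖ξ‖ ^ d = (‖ξ‖ ^ 2) ^ ((d : ℝ) / 2) := by
        rw [← Real.rpow_natCast_mul hξ'.le, ← Real.rpow_natCast]
        congr 1; push_cast; ring
      rw [this]
      exact Real.rpow_le_rpow (by positivity) (by linarith) (by positivity)
    calc _ ≤ (((M : ℝ) ^ d)⁻¹ * (‖(M : ℝ)⁻¹ • ξ‖ ^ d)⁻¹) *
          (A * (‖(M : ℝ)⁻¹ • ξ‖ * (1 + ‖(M : ℝ)⁻¹ • ξ‖ ^ 2)⁻¹)) ^ 2 := by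
            gcongr
            exact hψ _
      _ = _ := by rw [hk]; ring
  refine (integral_mono_of_nonneg (.of_forall fun ξ => by positivity) ?_
    (.of_forall hbound)).trans (le_of_eq ?_)
  · exact (hki.comp_smul (inv_ne_zero hM.ne')).const_mul _
  · rw [integral_const_mul, Measure.integral_comp_smul]
    simp only [finrank_euclideanSpace, Fintype.card_fin, inv_pow, inv_inv, smul_eq_mul,
      abs_of_pos (pow_pos hM d)]
    field_simp

/-- Translation multiplies the transform by a character, and `|e^{-2πi e·ξ} - 1| ≤ 2π |e| |ξ|`
supplies the zero at the origin. -/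
theorem exists_norm_fourier_sub_translate_le (ρ : 𝓢(Space d, ℂ)) (e : Space d) :
    ∃ A : ℝ, ∀ ξ, ‖𝓕 (ρ - dilate 1 e ρ) ξ‖ ≤ A * (‖ξ‖ * (1 + ‖ξ‖ ^ 2)⁻¹) := by
  obtain ⟨C₀, -, hC₀⟩ := (𝓕 ρ).decay 0 0
  obtain ⟨C₂, -, hC₂⟩ := (𝓕 ρ).decay 2 0
  simp only [norm_iteratedFDeriv_zero, pow_zero, one_mul] at hC₀ hC₂
  refine ⟨2 * Real.pi * ‖e‖ * (C₀ + C₂), fun ξ => ?_⟩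
  have h1 : 𝓕 (ρ - dilate 1 e ρ) ξ =
      -((Real.fourierChar (-inner ℝ e ξ) : ℂ) - 1) * 𝓕 ρ ξ := by
    rw [sub_eq_add_neg, FourierTransform.fourier_add, FourierTransform.fourier_neg,
      _root_.add_apply, _root_.neg_apply,
      fourier_dilate 1 (by simp) e ρ ξ, Circle.smul_def]
    simp
    ring
  have h2 : ‖(Real.fourierChar (-inner ℝ e ξ) : ℂ) - 1‖ ≤ 2 * Real.pi * ‖e‖ * ‖ξ‖ := by
    rw [Real.fourierChar_apply, mul_comm _ Complex.I]
    refine (Real.norm_exp_I_mul_ofReal_sub_one_le).trans ?_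
    rw [norm_mul, norm_mul, norm_neg, Real.norm_of_nonneg Real.pi_pos.le]
    have := norm_inner_le_norm (𝕜 := ℝ) e ξ
    norm_num
    rw [mul_assoc (2 * Real.pi)]
    gcongr
    exact this
  have h3 : ‖𝓕 ρ ξ‖ ≤ (C₀ + C₂) * (1 + ‖ξ‖ ^ 2)⁻¹ := by
    rw [← div_eq_mul_inv, le_div_iff₀ (by positivity)]
    nlinarith [hC₀ ξ, hC₂ ξ]
  rw [h1, norm_mul, norm_neg]
  calc _ ≤ (2 * Real.pi * ‖e‖ * ‖ξ‖) * ((C₀ + C₂) * (1 + ‖ξ‖ ^ 2)⁻¹) := by gcongr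
    _ = _ := by ring

/-! ### Duality between `H^{d/2}` and `H^{-d/2}`. -/

theorem norm_toTemperedDistribution_apply_le (f : Lp ℂ 2 (volume : Measure (Space d)))
    (g : 𝓢(Space d, ℂ)) :
    ‖(f : 𝓢'(Space d, ℂ)) g‖ ≤
      ‖(g.toLp 2 : Lp ℂ 2 (volume : Measure (Space d)))‖ * ‖f‖ := by
  rw [Lp.toTemperedDistribution_apply]
  have h : ‖∫ x, g x • f x‖ₑ ≤ eLpNorm g 2 volume * eLpNorm f 2 volume := by
    refine (enorm_integral_le_lintegral_enorm _).trans ?_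
    rw [← eLpNorm_one_eq_lintegral_enorm]
    exact eLpNorm_smul_le_mul_eLpNorm (p := 2) (q := 2) (r := 1) (φ := (g : Space d → ℂ))
      (f := (f : Space d → ℂ)) (Lp.aestronglyMeasurable f) g.continuous.aestronglyMeasurable
  rw [SchwartzMap.norm_toLp, Lp.norm_def, ← ENNReal.toReal_mul, ← toReal_enorm]
  exact ENNReal.toReal_mono (ENNReal.mul_ne_top (g.eLpNorm_lt_top 2 volume).ne (Lp.eLpNorm_ne_top f)) h

/-- Transposing the multiplier onto a test function exchanges `𝓕` and `𝓕⁻`; the Bessel symbol is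
even, so the operator is unchanged. -/
theorem fourier_smulLeftCLM_fourierInv (s : ℝ) (χ : 𝓢(Space d, ℂ)) :
    𝓕 (SchwartzMap.smulLeftCLM ℂ (fun x : Space d ↦ (((1 + ‖x‖ ^ 2) ^ (s / 2) : ℝ) : ℂ)) (𝓕⁻ χ)) =
      bessel s χ := by
  ext x
  rw [bessel, SchwartzMap.fourierMultiplierCLM_apply, SchwartzMap.fourierInv_coe,
    Real.fourierInv_eq_fourier_comp_neg, SchwartzMap.fourier_coe]
  refine congrArg (fun h : Space d → ℂ => 𝓕 h x) (funext fun ξ => ?_)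
  rw [SchwartzMap.smulLeftCLM_apply_apply (by fun_prop),
    SchwartzMap.smulLeftCLM_apply_apply (by fun_prop), norm_neg,
    SchwartzMap.fourierInv_coe, SchwartzMap.fourier_coe, Real.fourierInv_eq_fourier_neg]

theorem exists_norm_apply_dilate_le (hd : 1 ≤ d) {ψ : 𝓢(Space d, ℂ)} {A : ℝ}
    (hψ : ∀ ξ, ‖𝓕 ψ ξ‖ ≤ A * (‖ξ‖ * (1 + ‖ξ‖ ^ 2)⁻¹)) {T : 𝓢'(Space d, ℂ)}
    (hT : TemperedDistribution.MemSobolev ((d : ℝ) / 2) 2 T) :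
    ∃ C : ℝ, ∀ M : ℝˣ, (0 : ℝ) < M → ∀ x₀ : Space d,
      ‖T ((M : ℝ) ^ d • dilate M x₀ ψ)‖ ≤ C := by
  obtain ⟨f, hf⟩ := hT
  obtain ⟨C, hC⟩ := exists_norm_bessel_neg_dilate_le hd hψ
  refine ⟨√C * ‖f‖, fun M hM x₀ => ?_⟩
  have hTf : T = TemperedDistribution.besselPotential (Space d) ℂ (-((d : ℝ) / 2))
      (f : 𝓢'(Space d, ℂ)) :=
    ((TemperedDistribution.besselPotential_neg_apply_eq_iff _ _ _).2 hf).symm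
  rw [hTf, TemperedDistribution.besselPotential,
    TemperedDistribution.fourierMultiplierCLM_apply_apply, fourier_smulLeftCLM_fourierInv]
  refine (norm_toTemperedDistribution_apply_le _ _).trans ?_
  gcongr
  exact Real.le_sqrt_of_sq_le (hC M hM x₀)


/-! ### Unbounded functions with small critical Sobolev norm -/

/-- The square grows like `N` and not `N²`: a new term adds at most `C` on the diagonal and `2 C`
from the cross terms, whose geometric series is at most `1`. -/
theorem norm_sum_range_sq_le {H : Type*} [NormedAddCommGroup H] [InnerProductSpace ℂ H]
    {F : ℕ → H} {C : ℝ} (hC : 0 ≤ C)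
    (hF : ∀ i j, i ≤ j → ‖inner ℂ (F i) (F j)‖ ≤ C * ((2 : ℝ) ^ i / 2 ^ j)) (N : ℕ) :
    ‖∑ i ∈ Finset.range N, F i‖ ^ 2 ≤ 3 * C * N := by
  induction N with
  | zero => simp
  | succ N ih =>
    have h1 : ‖inner ℂ (∑ i ∈ Finset.range N, F i) (F N)‖ ≤ C := by
      rw [sum_inner]
      refine (norm_sum_le _ _).trans ((Finset.sum_le_sum fun i hi =>
        hF i N (Finset.mem_range.1 hi).le).trans ?_)
      rw [← Finset.mul_sum, ← Finset.sum_div, geom_sum_eq (by norm_num)]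
      refine mul_le_of_le_one_right hC ?_
      rw [div_le_one (by positivity)]
      norm_num
    have h2 : ‖F N‖ ^ 2 ≤ C := by
      have := hF N N le_rfl
      rw [div_self (by positivity), mul_one, inner_self_eq_norm_sq_to_K] at this
      simpa using this
    have h3 := (RCLike.re_le_norm (inner ℂ (∑ i ∈ Finset.range N, F i) (F N))).trans h1
    rw [Finset.sum_range_succ, norm_add_sq (𝕜 := ℂ)]
    push_cast
    linarith

/-- The invertible real number `2 ^ j`. -/
def twoPow (j : ℕ) : ℝˣ := Units.mk0 2 two_ne_zero ^ j

@[simp]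
theorem coe_twoPow (j : ℕ) : (twoPow j : ℝ) = 2 ^ j := by simp [twoPow]

/-- The order of the quantifiers matters: `η` depends on `ε` alone, so that `h` and `a ≤ η` can be
chosen together before the number `N` of scales. -/
theorem exists_norm_bessel_log_average_le (hd : 1 ≤ d) (φ : 𝓢(Space d, ℂ)) {ε : ℝ} (hε : 0 < ε) :
    ∃ η > 0, ∀ h : ℝ, ∃ N : ℕ, 0 < N ∧ ∀ a : ℝ, |a| ≤ η → ∀ x₀ : Space d,
      ‖((bessel ((d : ℝ) / 2) ((h / N) • ∑ j ∈ Finset.range N, dilate (twoPow j) x₀ φ +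
        a • dilate (twoPow (N + 3)) x₀ φ)).toLp 2 : Lp ℂ 2 (volume : Measure (Space d)))‖ ≤ ε := by
  obtain ⟨C, hC, hbound⟩ := exists_norm_inner_bessel_dilate_le φ
  refine ⟨ε / (2 * (√C + 1)), by positivity, fun h => ?_⟩
  -- This makes `(h / N)² * 3 C N = 3 C h² / N` at most `(ε / 2)²`.
  obtain ⟨N, hN⟩ := exists_nat_gt (12 * C * h ^ 2 / ε ^ 2)
  have hN0 : 0 < N := by
    rcases Nat.eq_zero_or_pos N with rfl | h0
    · exact absurd hN (not_lt.2 (by simp; positivity))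
    · exact h0
  refine ⟨N, hN0, fun a ha x₀ => ?_⟩
  set F : ℕ → Lp ℂ 2 (volume : Measure (Space d)) := fun j =>
    (bessel ((d : ℝ) / 2) (dilate (twoPow j) x₀ φ)).toLp 2 with hF
  have hdecomp : ((bessel ((d : ℝ) / 2) ((h / N) • ∑ j ∈ Finset.range N, dilate (twoPow j) x₀ φ +
        a • dilate (twoPow (N + 3)) x₀ φ)).toLp 2 : Lp ℂ 2 (volume : Measure (Space d))) =
      (h / N) • ∑ j ∈ Finset.range N, F j + a • F (N + 3) := by
    have hL : ∀ g : 𝓢(Space d, ℂ), (((bessel ((d : ℝ) / 2)) g).toLp 2 :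
        Lp ℂ 2 (volume : Measure (Space d))) =
        (SchwartzMap.toLpCLM ℂ ℂ 2 volume ∘L bessel ((d : ℝ) / 2)) g := fun g => rfl
    rw [hL, map_add, ContinuousLinearMap.map_smul_of_tower, ContinuousLinearMap.map_smul_of_tower,
      map_sum]
    rfl
  have hFF : ∀ i j, i ≤ j → ‖inner ℂ (F i) (F j)‖ ≤ C * ((2 : ℝ) ^ i / 2 ^ j) := by
    intro i j hij
    have h2 : (2 : ℝ) ^ i ≤ 2 ^ j := pow_le_pow_right₀ (by norm_num) hij
    refine (hbound (twoPow i) (twoPow j) (by simpa using one_le_pow₀ (by norm_num))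
      (by simpa using h2) x₀).trans ?_
    gcongr
    simp only [coe_twoPow]
    exact pow_le_of_le_one (by positivity) ((div_le_one (by positivity)).2 h2) (by omega)
  have h1 : ‖∑ j ∈ Finset.range N, F j‖ ≤ √(3 * C * N) :=
    Real.le_sqrt_of_sq_le (norm_sum_range_sq_le hC hFF N)
  have h2 : ‖F (N + 3)‖ ≤ √C := by
    refine Real.le_sqrt_of_sq_le ?_
    have := hFF (N + 3) (N + 3) le_rfl
    rw [div_self (by positivity), mul_one, inner_self_eq_norm_sq_to_K] at this
    simpa using this
  have hNpos : (0 : ℝ) < N := by exact_mod_cast hN0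
  have h3 : |h / N| * √(3 * C * N) ≤ ε / 2 := by
    refine abs_le_of_sq_le_sq' ?_ (by positivity) |>.2
    rw [mul_pow, sq_abs, Real.sq_sqrt (by positivity)]
    rw [div_lt_iff₀ (by positivity)] at hN
    have : (h / N) ^ 2 * (3 * C * N) = 3 * C * h ^ 2 / N := by field_simp
    rw [this, div_le_iff₀ hNpos]
    nlinarith
  have h4 : |a| * √C ≤ ε / 2 := by
    have h5 : 0 ≤ √C := Real.sqrt_nonneg _
    calc |a| * √C ≤ ε / (2 * (√C + 1)) * (√C + 1) := by gcongr; linarith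
      _ = ε / 2 := by field_simp
  rw [hdecomp]
  calc _ ≤ ‖(h / N) • ∑ j ∈ Finset.range N, F j‖ + ‖a • F (N + 3)‖ := norm_add_le _ _
    _ = |h / N| * ‖∑ j ∈ Finset.range N, F j‖ + |a| * ‖F (N + 3)‖ := by
        rw [norm_smul, norm_smul, Real.norm_eq_abs, Real.norm_eq_abs]
    _ ≤ |h / N| * √(3 * C * N) + |a| * √C := by gcongr
    _ ≤ ε := by linarith

/-- The gap is made exactly `K / h` by the intermediate value theorem in `a`; its product with `h`
is then `K`, and it is at most `1 / K` once `h ≥ K²`. -/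
theorem exists_height {σ : ℝ} (hσ : 0 < σ) {ε K : ℝ} (hε : 0 < ε) (hK : 0 < K) :
    ∃ h a : ℝ, 0 < h ∧ 0 < a ∧ a ≤ ε ∧ 0 < (h + a) ^ (2 * σ) - h ^ (2 * σ) ∧
      (h + a) ^ (2 * σ) - h ^ (2 * σ) ≤ 1 / K ∧ K ≤ h * ((h + a) ^ (2 * σ) - h ^ (2 * σ)) := by
  obtain ⟨h, hh, hεh, hKh, h0⟩ :=
    ((((tendsto_rpow_atTop (y := 2 * σ) (by positivity)).eventually_ge_atTop (K / (σ * ε))).and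
      ((Filter.eventually_ge_atTop ε).and ((Filter.eventually_ge_atTop (K ^ 2)).and
        (Filter.eventually_gt_atTop (0 : ℝ)))))).exists
  have hcont : ContinuousOn (fun a : ℝ => (h + a) ^ (2 * σ) - h ^ (2 * σ)) (Icc 0 ε) := by
    refine ContinuousOn.sub (ContinuousOn.rpow_const (by fun_prop) fun a ha => ?_)
      continuousOn_const
    exact Or.inr (by positivity)
  -- By the mean value theorem the gap at `a = ε` is `2 σ ε y^{2σ-1}` with `h < y < h + ε ≤ 2 h`.
  -- Bounding `y^{2σ}` and `y` separately covers both signs of `2σ - 1`.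
  have hε' : K / h ≤ (h + ε) ^ (2 * σ) - h ^ (2 * σ) := by
    obtain ⟨y, hy, hyd⟩ := exists_hasDerivAt_eq_slope (fun x : ℝ => x ^ (2 * σ))
      (fun x => 2 * σ * x ^ (2 * σ - 1)) (show h < h + ε by linarith)
      (ContinuousOn.rpow_const (by fun_prop) fun a _ => Or.inr (by positivity))
      (fun x hx => Real.hasDerivAt_rpow_const (Or.inl (h0.trans hx.1).ne'))
    have hy0 : 0 < y := h0.trans hy.1
    rw [add_sub_cancel_left, eq_div_iff hε.ne'] at hyd
    rw [← hyd, div_le_iff₀ h0]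
    have h1 : h ^ (2 * σ) ≤ y ^ (2 * σ) := Real.rpow_le_rpow h0.le hy.1.le (by positivity)
    have h2 : y ^ (2 * σ) = y ^ (2 * σ - 1) * y := by
      rw [← Real.rpow_add_one hy0.ne']; ring_nf
    have h3 : 0 < y ^ (2 * σ - 1) := Real.rpow_pos_of_pos hy0 _
    rw [div_le_iff₀ (by positivity)] at hh
    have h4 : y ≤ 2 * h := by linarith [hy.2]
    calc K ≤ y ^ (2 * σ) * (σ * ε) := hh.trans (by gcongr)
      _ = σ * ε * y ^ (2 * σ - 1) * y := by rw [h2]; ring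
      _ ≤ σ * ε * y ^ (2 * σ - 1) * (2 * h) := by gcongr
      _ = _ := by ring
  obtain ⟨a, ha, hKa⟩ := intermediate_value_Icc hε.le hcont
    (show K / h ∈ Icc _ _ from ⟨by simp only [add_zero, sub_self]; positivity, hε'⟩)
  have hpos : 0 < K / h := by positivity
  simp only at hKa
  refine ⟨h, a, h0, lt_of_le_of_ne ha.1 ?_, ha.2, ?_, ?_, ?_⟩
  · rintro rfl
    simp only [add_zero, sub_self] at hKa
    exact hpos.ne hKa
  · rwa [hKa]
  · rw [hKa, div_le_div_iff₀ h0 hK]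
    nlinarith
  · rw [hKa]
    exact (mul_div_cancel₀ K h0.ne').ge



/-! ### The initial datum -/

/-- A smooth function equal to `1` near `0` and supported in the unit ball. -/
def cutoff (d : ℕ) : ContDiffBump (0 : Space d) where
  rIn := 1 / 2
  rOut := 1
  rIn_pos := by norm_num
  rIn_lt_rOut := by norm_num

/-- A smooth compactly supported real function, seen as a complex Schwartz function. -/
def realToSchwartz (f : Space d → ℝ) (hf : ContDiff ℝ ∞ f) (hf' : HasCompactSupport f) :
    𝓢(Space d, ℂ) :=
  HasCompactSupport.toSchwartzMap (f := fun x => ((f x : ℝ) : ℂ))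
    (hf'.comp_left (g := fun r : ℝ => (r : ℂ)) Complex.ofReal_zero)
    (Complex.ofRealCLM.contDiff.comp hf)

/-- The Schwartz function `cutoff d`. -/
def cutoffS (d : ℕ) : 𝓢(Space d, ℂ) :=
  realToSchwartz (cutoff d) (cutoff d).contDiff (cutoff d).hasCompactSupport

theorem cutoff_eq_one {x : Space d} (hx : ‖x‖ ≤ 1 / 2) : cutoff d x = 1 :=
  (cutoff d).one_of_mem_closedBall (by simpa [cutoff] using hx)

theorem cutoff_eq_zero {x : Space d} (hx : 1 ≤ ‖x‖) : cutoff d x = 0 :=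
  (cutoff d).zero_of_le_dist (by simpa [cutoff] using hx)

/-- A function of height about `h` at `x₀`, constant near `x₀` up to a bump of height `a` at the
smaller scale `2 ^ (-(N + 3))`. -/
def block (h a : ℝ) (N : ℕ) (x₀ x : Space d) : ℝ :=
  (h / N) * ∑ j ∈ Finset.range N, cutoff d ((2 : ℝ) ^ j • (x - x₀)) +
    a * cutoff d ((2 : ℝ) ^ (N + 3) • (x - x₀))

/-- The Schwartz function `block h a N x₀`. -/
def blockS (h a : ℝ) (N : ℕ) (x₀ : Space d) : 𝓢(Space d, ℂ) :=
  (h / N) • ∑ j ∈ Finset.range N, dilate (twoPow j) x₀ (cutoffS d) +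
    a • dilate (twoPow (N + 3)) x₀ (cutoffS d)

theorem blockS_apply (h a : ℝ) (N : ℕ) (x₀ x : Space d) :
    blockS h a N x₀ x = (block h a N x₀ x : ℂ) := by
  simp only [blockS, block, _root_.add_apply, _root_.smul_apply, _root_.sum_apply, dilate_apply,
    coe_twoPow]
  push_cast
  simp only [Complex.real_smul]
  push_cast
  rfl

theorem continuous_block (h a : ℝ) (N : ℕ) (x₀ : Space d) : Continuous (block h a N x₀) := by
  have := (cutoff d).continuous
  unfold block
  fun_prop

theorem block_nonneg {h a : ℝ} (hh : 0 ≤ h) (ha : 0 ≤ a) (N : ℕ) (x₀ x : Space d) :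
    0 ≤ block h a N x₀ x :=
  add_nonneg (mul_nonneg (by positivity) (Finset.sum_nonneg fun _ _ => (cutoff d).nonneg))
    (mul_nonneg ha (cutoff d).nonneg)

theorem block_eq_zero (h a : ℝ) (N : ℕ) {x₀ x : Space d} (hx : 1 ≤ ‖x - x₀‖) :
    block h a N x₀ x = 0 := by
  have : ∀ j : ℕ, cutoff d ((2 : ℝ) ^ j • (x - x₀)) = 0 := fun j => by
    refine cutoff_eq_zero ?_
    rw [norm_smul, Real.norm_of_nonneg (by positivity)]
    exact one_le_mul_of_one_le_of_one_le (one_le_pow₀ (by norm_num)) hx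
  simp [block, this]

/-- The shift `3` in the exponent provides the room: `4 / 2³ = 1 / 2` is the radius on which
`cutoff` equals one, so every coarse bump is flat throughout the region where the fine bump and the
dipole live. -/
theorem block_of_norm_le (h a : ℝ) {N : ℕ} (hN : 0 < N) {x₀ x : Space d}
    (hx : ‖(2 : ℝ) ^ (N + 3) • (x - x₀)‖ ≤ 4) :
    block h a N x₀ x = h + a * cutoff d ((2 : ℝ) ^ (N + 3) • (x - x₀)) := by
  have : ∀ j ∈ Finset.range N, cutoff d ((2 : ℝ) ^ j • (x - x₀)) = 1 := fun j hj => by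
    refine cutoff_eq_one ?_
    have hj' : (2 : ℝ) ^ j ≤ 2 ^ N := pow_le_pow_right₀ (by norm_num) (Finset.mem_range.1 hj).le
    rw [norm_smul, Real.norm_of_nonneg (by positivity)] at hx ⊢
    rw [pow_add] at hx
    nlinarith [mul_le_mul_of_nonneg_right hj' (norm_nonneg (x - x₀))]
  rw [block, Finset.sum_congr rfl this]
  have hN' : (N : ℝ) ≠ 0 := by positivity
  simp [hN']

/-- A unit vector of `ℝ^d`, `d ≥ 1`. -/
def unitVec (hd : 1 ≤ d) : Space d := EuclideanSpace.single ⟨0, hd⟩ 1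

theorem norm_unitVec (hd : 1 ≤ d) : ‖unitVec hd‖ = 1 := by simp [unitVec]

/-- The centre of the `k`-th block. -/
def centre (hd : 1 ≤ d) (k : ℕ) : Space d := (4 * k : ℝ) • unitVec hd

theorem four_le_norm_centre_sub (hd : 1 ≤ d) {k l : ℕ} (hkl : k ≠ l) :
    4 ≤ ‖centre hd k - centre hd l‖ := by
  rw [centre, centre, ← sub_smul, norm_smul, norm_unitVec, mul_one, ← mul_sub, norm_mul]
  have : (1 : ℝ) ≤ |(k : ℝ) - l| := by
    have : (1 : ℤ) ≤ |(k : ℤ) - l| := Int.one_le_abs (by omega)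
    exact_mod_cast this
  simpa using this

theorem four_mul_sub_le_norm (hd : 1 ≤ d) (k : ℕ) (x : Space d) :
    4 * k - ‖x‖ ≤ ‖x - centre hd k‖ := by
  have h1 : ‖centre hd k‖ = 4 * k := by
    rw [centre, norm_smul, norm_unitVec, mul_one]; simp
  have := norm_sub_norm_le (centre hd k) x
  rw [h1, norm_sub_rev] at this
  exact this

/-- The superposition of the blocks. -/
def superposition (hd : 1 ≤ d) (h a : ℕ → ℝ) (N : ℕ → ℕ) (x : Space d) : ℝ :=
  ∑ᶠ k, block (h k) (a k) (N k) (centre hd k) x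

theorem superposition_eq_sum (hd : 1 ≤ d) (h a : ℕ → ℝ) (N : ℕ → ℕ) {n : ℕ} {x : Space d}
    (hx : ‖x‖ < n) : superposition hd h a N x =
      ∑ k ∈ Finset.range n, block (h k) (a k) (N k) (centre hd k) x := by
  refine finsum_eq_sum_of_support_subset _ fun k hk => ?_
  rw [Finset.coe_range, mem_Iio]
  by_contra hkn
  refine hk (block_eq_zero _ _ _ ?_)
  have h1 : (n : ℝ) ≤ k := by exact_mod_cast not_lt.1 hkn
  have h2 : (1 : ℝ) ≤ n := by
    have : (0 : ℝ) < n := (norm_nonneg x).trans_lt hx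
    exact_mod_cast this
  linarith [four_mul_sub_le_norm hd k x]

theorem continuous_superposition (hd : 1 ≤ d) (h a : ℕ → ℝ) (N : ℕ → ℕ) :
    Continuous (superposition hd h a N) := by
  rw [continuous_iff_continuousAt]
  intro x
  obtain ⟨n, hn⟩ := exists_nat_gt ‖x‖
  have hev : superposition hd h a N =ᶠ[𝓝 x]
      fun x => ∑ k ∈ Finset.range n, block (h k) (a k) (N k) (centre hd k) x := by
    filter_upwards [(isOpen_lt continuous_norm continuous_const).mem_nhds hn] with y hy
    exact superposition_eq_sum hd h a N hy
  refine ContinuousAt.congr ?_ hev.symm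
  exact (continuous_finsetSum _ fun k _ => continuous_block _ _ _ _).continuousAt

theorem superposition_nonneg (hd : 1 ≤ d) {h a : ℕ → ℝ} (hh : ∀ k, 0 ≤ h k) (ha : ∀ k, 0 ≤ a k)
    (N : ℕ → ℕ) (x : Space d) : 0 ≤ superposition hd h a N x :=
  finsum_nonneg fun k => block_nonneg (hh k) (ha k) _ _ _

theorem superposition_of_norm_le (hd : 1 ≤ d) (h a : ℕ → ℝ) {N : ℕ → ℕ} (hN : ∀ k, 0 < N k)
    (k : ℕ) {x : Space d} (hx : ‖(2 : ℝ) ^ (N k + 3) • (x - centre hd k)‖ ≤ 4) :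
    superposition hd h a N x =
      h k + a k * cutoff d ((2 : ℝ) ^ (N k + 3) • (x - centre hd k)) := by
  rw [← block_of_norm_le (h k) (a k) (hN k) hx]
  refine finsum_eq_single _ k fun l hl => block_eq_zero _ _ _ ?_
  have h1 := four_le_norm_centre_sub hd hl
  have h2 : ‖x - centre hd k‖ ≤ 1 := by
    rw [norm_smul, Real.norm_of_nonneg (by positivity)] at hx
    have : (4 : ℝ) ≤ 2 ^ (N k + 3) := by
      calc (4 : ℝ) ≤ 2 ^ 3 := by norm_num
        _ ≤ _ := pow_le_pow_right₀ (by norm_num) (by omega)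
    nlinarith [norm_nonneg (x - centre hd k)]
  have h3 := norm_sub_le_norm_sub_add_norm_sub (centre hd l) x (centre hd k)
  rw [norm_sub_rev (centre hd l) x] at h3
  linarith

/-- The series converges in the Sobolev norm, while the function is a locally finite sum. The two
agree because a compactly supported test function meets only finitely many blocks. -/
theorem besselPotential_tsum_apply (hd : 1 ≤ d) (s : ℝ) (h a : ℕ → ℝ) (N : ℕ → ℕ)
    (hsum : Summable fun k => ((bessel s (blockS (h k) (a k) (N k) (centre hd k))).toLp 2 :
      Lp ℂ 2 (volume : Measure (Space d)))) (φ : 𝓓((⊤ : Opens (Space d)), ℝ)) :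
    TemperedDistribution.besselPotential (Space d) ℂ (-s)
      ((∑' k, (bessel s (blockS (h k) (a k) (N k) (centre hd k))).toLp 2 :
        Lp ℂ 2 (volume : Measure (Space d))) : 𝓢'(Space d, ℂ)) (testToSchwartz φ) =
      ∫ x, ((φ x : ℝ) : ℂ) * superposition hd h a N x := by
  set L : Lp ℂ 2 (volume : Measure (Space d)) →L[ℂ] ℂ :=
    (PointwiseConvergenceCLM.evalCLM (RingHom.id ℂ) ℂ (testToSchwartz φ)) ∘L
      TemperedDistribution.besselPotential (Space d) ℂ (-s) ∘L
      Lp.toTemperedDistributionCLM ℂ volume 2 with hL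
  set F : ℕ → Lp ℂ 2 (volume : Measure (Space d)) := fun k =>
    (bessel s (blockS (h k) (a k) (N k) (centre hd k))).toLp 2 with hF
  have hLk : ∀ k, L (F k) = ∫ x, ((φ x : ℝ) : ℂ) * block (h k) (a k) (N k) (centre hd k) x := by
    intro k
    have : L (F k) = TemperedDistribution.besselPotential (Space d) ℂ (-s)
        (F k : 𝓢'(Space d, ℂ)) (testToSchwartz φ) := rfl
    rw [this, hF, ← besselPotential_coe,
      TemperedDistribution.besselPotential_besselPotential_apply, add_neg_cancel,
      TemperedDistribution.besselPotential_zero]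
    simp only [ContinuousLinearMap.id_apply, SchwartzMap.toTemperedDistributionCLM_apply_apply,
      blockS_apply]
    rfl
  have h1 : L (∑' k, F k) = ∑' k, L (F k) := L.map_tsum hsum
  refine h1.trans ?_
  obtain ⟨R, hR⟩ := φ.hasCompactSupport.isBounded.exists_norm_le
  obtain ⟨n, hn⟩ := exists_nat_gt R
  have hsupp : ∀ x, (n : ℝ) ≤ ‖x‖ → φ x = 0 := fun x hx => by
    by_contra h0
    linarith [hR x (subset_tsupport _ h0)]
  rw [tsum_eq_sum (s := Finset.range n)]
  · simp_rw [hLk]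
    rw [← integral_finsetSum]
    · refine integral_congr_ae (.of_forall fun x => ?_)
      dsimp only
      rcases lt_or_ge ‖x‖ n with hx | hx
      · rw [superposition_eq_sum hd h a N hx]
        push_cast
        rw [Finset.mul_sum]
      · simp [hsupp x hx]
    · intro k _
      refine Continuous.integrable_of_hasCompactSupport ?_ ?_
      · have := continuous_block (h k) (a k) (N k) (centre hd k)
        have := φ.continuous
        fun_prop
      · refine HasCompactSupport.mul_right ?_
        exact φ.hasCompactSupport.comp_left (g := fun r : ℝ => (r : ℂ)) Complex.ofReal_zero
  · intro k hk
    rw [hLk]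
    refine integral_eq_zero_of_ae (.of_forall fun x => ?_)
    dsimp only
    rcases lt_or_ge ‖x‖ n with hx | hx
    · rw [block_eq_zero]
      · simp
      · have h1 : (n : ℝ) ≤ k := by exact_mod_cast not_lt.1 (Finset.mem_range.not.1 hk)
        have h2 : (1 : ℝ) ≤ n := by
          have : (0 : ℝ) < n := (norm_nonneg x).trans_lt hx
          exact_mod_cast this
        linarith [four_mul_sub_le_norm hd k x]
    · simp [hsupp x hx]

theorem exists_initial_datum (hd : 1 ≤ d) {σ δ : ℝ} (hσ : 0 < σ) (hδ : 0 < δ) :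
    ∃ v : Space d → ℝ, Continuous v ∧ (∀ x, 0 ≤ v x) ∧
      (∃ F : Lp ℂ 2 (volume : Measure (Space d)), ‖F‖ ≤ δ ∧
        ∀ φ : 𝓓((⊤ : Opens (Space d)), ℝ),
          TemperedDistribution.besselPotential (Space d) ℂ (-((d : ℝ) / 2))
            (F : 𝓢'(Space d, ℂ)) (testToSchwartz φ) = ∫ x, ((φ x : ℝ) : ℂ) * v x) ∧
      ∀ K : ℝ, 0 < K → ∃ (M : ℝˣ) (x₀ : Space d) (h a : ℝ), (0 : ℝ) < M ∧ 0 < h ∧ 0 < a ∧ a ≤ 1 ∧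
        0 < (h + a) ^ (2 * σ) - h ^ (2 * σ) ∧ (h + a) ^ (2 * σ) - h ^ (2 * σ) ≤ 1 / K ∧
        K ≤ h * ((h + a) ^ (2 * σ) - h ^ (2 * σ)) ∧
        (∀ x, ‖(M : ℝ) • (x - x₀)‖ < 1 / 2 → v x = h + a) ∧
        ∀ x, ‖(M : ℝ) • (x - x₀) - (3 : ℝ) • unitVec hd‖ < 1 / 2 → v x = h := by
  have hε : ∀ k : ℕ, 0 < δ / 2 / 2 ^ k := fun k => by positivity
  -- For each `k`, the tolerance `η k` comes first, then the heights `h k` and `a k` with `K = k +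
  -- 1`, and last the number of scales `N k`. The budgets `δ / 2 / 2 ^ k` add up to `δ`.
  choose η hη hNη using fun k => exists_norm_bessel_log_average_le hd (cutoffS d) (hε k)
  have hmin : ∀ k, 0 < min (η k) 1 := fun k => lt_min (hη k) one_pos
  choose h a hh ha haη hD hDK hhD using fun k : ℕ =>
    exists_height hσ (hmin k) (show (0 : ℝ) < k + 1 by positivity)
  choose N hN hbound using fun k => hNη k (h k)
  have hF : ∀ k, ‖((bessel ((d : ℝ) / 2) (blockS (h k) (a k) (N k) (centre hd k))).toLp 2 :
      Lp ℂ 2 (volume : Measure (Space d)))‖ ≤ δ / 2 / 2 ^ k := fun k =>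
    hbound k (a k) (by rw [abs_of_pos (ha k)]; exact (haη k).trans (min_le_left _ _)) _
  have hgeom := hasSum_geometric_two' δ
  refine ⟨superposition hd h a N, continuous_superposition hd h a N,
    superposition_nonneg hd (fun k => (hh k).le) (fun k => (ha k).le) N,
    ⟨_, tsum_of_norm_bounded hgeom hF,
      besselPotential_tsum_apply hd _ h a N (.of_norm_bounded hgeom.summable hF)⟩, ?_⟩
  intro K hK
  obtain ⟨k, hk⟩ := exists_nat_gt K
  refine ⟨twoPow (N k + 3), centre hd k, h k, a k, by simp, hh k, ha k,
    (haη k).trans (min_le_right _ _), hD k, (hDK k).trans ?_, le_trans ?_ (hhD k), ?_, ?_⟩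
  · exact one_div_le_one_div_of_le hK (by linarith)
  · linarith
  · intro x hx
    rw [coe_twoPow] at hx
    rw [superposition_of_norm_le hd h a hN k (by linarith), cutoff_eq_one hx.le, mul_one]
  · intro x hx
    rw [coe_twoPow] at hx
    -- On this ball the rescaled distance to the centre lies between `5/2` and `7/2`: beyond the
    -- fine bump, which ends at `1`, and inside the plateau, which reaches `4`.
    have h1 : ‖(3 : ℝ) • unitVec hd‖ = 3 := by rw [norm_smul, norm_unitVec]; norm_num
    have h2 := norm_sub_norm_le ((2 : ℝ) ^ (N k + 3) • (x - centre hd k)) ((3 : ℝ) • unitVec hd)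
    have h3 := norm_sub_norm_le ((3 : ℝ) • unitVec hd) ((2 : ℝ) ^ (N k + 3) • (x - centre hd k))
    rw [norm_sub_rev] at h3
    rw [superposition_of_norm_le hd h a hN k (by linarith), cutoff_eq_zero (by linarith), mul_zero,
      add_zero]


/-! ### The flow of the ordinary differential equation and its loss of regularity -/

/-- The value at time `t` of the solution of `i w' = lam |w|^{2σ} w`, `w(0) = z`. -/
def flow (lam σ t : ℝ) (z : ℂ) : ℂ :=
  Complex.exp (Complex.I * ((-(lam * t * ‖z‖ ^ (2 * σ)) : ℝ) : ℂ)) * z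

theorem norm_flow (lam σ t : ℝ) (z : ℂ) : ‖flow lam σ t z‖ = ‖z‖ := by
  rw [flow, norm_mul, mul_comm Complex.I, Complex.norm_exp_ofReal_mul_I, one_mul]

theorem flow_zero (lam σ : ℝ) (z : ℂ) : flow lam σ 0 z = z := by simp [flow]

theorem nonlin_flow (lam σ t : ℝ) (z : ℂ) :
    nonlin σ (flow lam σ t z) = ((‖z‖ ^ (2 * σ) : ℝ) : ℂ) * flow lam σ t z := by
  rw [nonlin, norm_flow]

/-- Two vectors of length `h` separated by an angle `θ` with `|θ| = |lam| t D ≤ π` are at distance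
`2 h |sin (θ / 2)| ≥ (2 / π) h |θ|`. The lost `1` accounts for the extra height `a`. -/
theorem le_norm_flow_sub_flow {lam σ t h a K : ℝ} (hh : 0 < h) (ha : 0 < a) (ha1 : a ≤ 1)
    (ht : 0 < t) (hK : 0 < K) (hKt : |lam| * t ≤ Real.pi * K)
    (hD : 0 < (h + a) ^ (2 * σ) - h ^ (2 * σ)) (hDK : (h + a) ^ (2 * σ) - h ^ (2 * σ) ≤ 1 / K)
    (hhD : K ≤ h * ((h + a) ^ (2 * σ) - h ^ (2 * σ))) :
    2 / Real.pi * (|lam| * t) * K - 1 ≤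
      ‖flow lam σ t ((h + a : ℝ) : ℂ) - flow lam σ t (h : ℂ)‖ := by
  set D := (h + a) ^ (2 * σ) - h ^ (2 * σ) with hDdef
  set θ : ℝ := -(lam * t * D) with hθ
  set E : ℝ → ℂ := fun x => Complex.exp (Complex.I * ((-(lam * t * x) : ℝ) : ℂ)) with hE
  have hEn : ∀ x, ‖E x‖ = 1 := fun x => by
    rw [hE]
    dsimp only
    rw [mul_comm, Complex.norm_exp_ofReal_mul_I]
  have h1 : flow lam σ t ((h + a : ℝ) : ℂ) - flow lam σ t (h : ℂ) =
      h * E (h ^ (2 * σ)) * (Complex.exp (Complex.I * θ) - 1) + a * E ((h + a) ^ (2 * σ)) := by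
    have h2 : E ((h + a) ^ (2 * σ)) = E (h ^ (2 * σ)) * Complex.exp (Complex.I * θ) := by
      rw [hE]
      dsimp only
      rw [← Complex.exp_add, hθ, hDdef]
      congr 1
      push_cast
      ring
    simp only [flow, Complex.norm_real, Real.norm_of_nonneg hh.le,
      Real.norm_of_nonneg (add_pos hh ha).le]
    change E ((h + a) ^ (2 * σ)) * ((h + a : ℝ) : ℂ) - E (h ^ (2 * σ)) * h = _
    rw [h2]
    push_cast
    ring
  have habs : |θ| = |lam| * t * D := by
    rw [hθ, abs_neg, abs_mul, abs_mul, abs_of_pos ht, abs_of_pos hD]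
  have hθπ : |θ| ≤ Real.pi := by
    rw [habs]
    calc |lam| * t * D ≤ (Real.pi * K) * (1 / K) := by gcongr
      _ = Real.pi := by field_simp
  have h3 : 2 / Real.pi * |θ| ≤ ‖Complex.exp (Complex.I * θ) - 1‖ := by
    rw [Complex.norm_exp_I_mul_ofReal_sub_one, norm_mul, Real.norm_eq_abs, Real.norm_eq_abs]
    have h4 : |Real.sin (θ / 2)| = Real.sin (|θ| / 2) := by
      rcases abs_cases θ with ⟨h5, h6⟩ | ⟨h5, h6⟩
      · rw [h5, abs_of_nonneg (Real.sin_nonneg_of_nonneg_of_le_pi (by linarith) (by linarith))]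
      · have h7 : Real.sin (θ / 2) ≤ 0 :=
          Real.sin_nonpos_of_nonpos_of_neg_pi_le (by linarith) (by linarith)
        rw [h5, abs_of_nonpos h7, ← Real.sin_neg]
        congr 1
        ring
    have h5 := Real.mul_le_sin (x := |θ| / 2) (by positivity) (by linarith)
    rw [h4, abs_two]
    linarith
  rw [h1]
  have h6 := norm_sub_le_norm_add (h * E (h ^ (2 * σ)) * (Complex.exp (Complex.I * θ) - 1))
    (a * E ((h + a) ^ (2 * σ)))
  rw [norm_mul, norm_mul, norm_mul, hEn, hEn, Complex.norm_real, Complex.norm_real,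
    Real.norm_of_nonneg hh.le, Real.norm_of_nonneg ha.le] at h6
  refine le_trans ?_ h6
  have h7 : 2 / Real.pi * (|lam| * t) * K ≤ h * (2 / Real.pi * |θ|) := by
    rw [habs]
    calc _ ≤ 2 / Real.pi * (|lam| * t) * (h * D) := by gcongr
      _ = _ := by ring
  have h8 := mul_le_mul_of_nonneg_left h3 hh.le
  linarith

/-! ### Dipole test functions and the loss of regularity. -/

/-- A smooth function of integral one, supported in the ball of radius `1 / 2`. -/
def mollifier (d : ℕ) : Space d → ℝ :=
  (⟨1 / 4, 1 / 2, by norm_num, by norm_num⟩ : ContDiffBump (0 : Space d)).normed volume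

theorem contDiff_mollifier : ContDiff ℝ ∞ (mollifier d) := ContDiffBump.contDiff_normed _

theorem hasCompactSupport_mollifier : HasCompactSupport (mollifier d) :=
  ContDiffBump.hasCompactSupport_normed _

theorem integral_mollifier : ∫ x, mollifier d x = 1 := ContDiffBump.integral_normed _

theorem mollifier_eq_zero {x : Space d} (hx : 1 / 2 ≤ ‖x‖) : mollifier d x = 0 := by
  by_contra h
  have h1 : x ∈ Function.support (mollifier d) := h
  rw [mollifier, ContDiffBump.support_normed_eq, mem_ball_zero_iff] at h1
  exact absurd h1 (not_lt.2 hx)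

/-- A test function, from a smooth compactly supported function on the whole space. -/
def toTest (f : Space d → ℝ) (hf : ContDiff ℝ ∞ f) (hf' : HasCompactSupport f) :
    𝓓((⊤ : Opens (Space d)), ℝ) :=
  ⟨f, hf, hf', fun _ _ => trivial⟩

theorem hasCompactSupport_mollifier_comp (M : ℝˣ) (x₀ e : Space d) :
    HasCompactSupport fun x => mollifier d ((M : ℝ) • (x - x₀) - e) := by
  have h := hasCompactSupport_mollifier (d := d).comp_homeomorph
    ((Homeomorph.subRight x₀).trans ((Homeomorph.smulOfNeZero (M : ℝ) M.ne_zero).trans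
      (Homeomorph.subRight e)))
  exact h

/-- The difference of two concentrated bumps near `x₀`, at scale `M⁻¹`. -/
def dipole (M : ℝˣ) (x₀ e : Space d) : 𝓓((⊤ : Opens (Space d)), ℝ) :=
  toTest (fun x => (M : ℝ) ^ d * (mollifier d ((M : ℝ) • (x - x₀) - 0) -
      mollifier d ((M : ℝ) • (x - x₀) - e)))
    (by have := contDiff_mollifier (d := d); fun_prop)
    (((hasCompactSupport_mollifier_comp M x₀ 0).sub
      (hasCompactSupport_mollifier_comp M x₀ e)).mul_left)

theorem testToSchwartz_dipole (M : ℝˣ) (x₀ e : Space d) :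
    testToSchwartz (dipole M x₀ e) = (M : ℝ) ^ d • dilate M x₀
      (realToSchwartz (mollifier d) contDiff_mollifier hasCompactSupport_mollifier -
        dilate 1 e (realToSchwartz (mollifier d) contDiff_mollifier
          hasCompactSupport_mollifier)) := by
  ext x
  simp only [_root_.smul_apply, _root_.sub_apply, dilate_apply, Complex.real_smul, Units.val_one,
    one_smul]
  change (((M : ℝ) ^ d * (mollifier d ((M : ℝ) • (x - x₀) - 0) -
      mollifier d ((M : ℝ) • (x - x₀) - e)) : ℝ) : ℂ) = _ * ((mollifier d _ : ℂ) - mollifier d _)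
  push_cast
  rw [sub_zero]

theorem integral_mollifier_comp (M : ℝˣ) (hM : (0 : ℝ) < M) (x₀ e : Space d) :
    ∫ x, (((M : ℝ) ^ d * mollifier d ((M : ℝ) • (x - x₀) - e) : ℝ) : ℂ) = 1 := by
  rw [integral_complex_ofReal, integral_const_mul,
    integral_sub_right_eq_self (fun x => mollifier d ((M : ℝ) • x - e)) x₀,
    Measure.integral_comp_smul volume (fun x => mollifier d (x - e)),
    integral_sub_right_eq_self (fun x => mollifier d x) e, integral_mollifier]
  simp [abs_of_pos hM]

theorem integral_dipole_mul {M : ℝˣ} (hM : (0 : ℝ) < M) {x₀ e : Space d} {U : Space d → ℂ}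
    {A B : ℂ} (hA : ∀ x, ‖(M : ℝ) • (x - x₀)‖ < 1 / 2 → U x = A)
    (hB : ∀ x, ‖(M : ℝ) • (x - x₀) - e‖ < 1 / 2 → U x = B) :
    ∫ x, ((dipole M x₀ e x : ℝ) : ℂ) * U x = A - B := by
  have hint : ∀ e : Space d, Integrable fun x =>
      (((M : ℝ) ^ d * mollifier d ((M : ℝ) • (x - x₀) - e) : ℝ) : ℂ) := fun e => by
    have h := contDiff_mollifier (d := d).continuous
    have h' : Continuous fun x => (M : ℝ) ^ d * mollifier d ((M : ℝ) • (x - x₀) - e) := by fun_prop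
    exact (h'.integrable_of_hasCompactSupport
      (hasCompactSupport_mollifier_comp M x₀ e).mul_left).ofReal
  have h1 : ∀ x, ((dipole M x₀ e x : ℝ) : ℂ) * U x =
      (((M : ℝ) ^ d * mollifier d ((M : ℝ) • (x - x₀) - 0) : ℝ) : ℂ) * A -
        (((M : ℝ) ^ d * mollifier d ((M : ℝ) • (x - x₀) - e) : ℝ) : ℂ) * B := by
    intro x
    have h2 : ((mollifier d ((M : ℝ) • (x - x₀) - 0) : ℝ) : ℂ) * U x =
        ((mollifier d ((M : ℝ) • (x - x₀) - 0) : ℝ) : ℂ) * A := by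
      rcases lt_or_ge ‖(M : ℝ) • (x - x₀)‖ (1 / 2) with h | h
      · rw [hA x h]
      · rw [sub_zero, mollifier_eq_zero h]; simp
    have h3 : ((mollifier d ((M : ℝ) • (x - x₀) - e) : ℝ) : ℂ) * U x =
        ((mollifier d ((M : ℝ) • (x - x₀) - e) : ℝ) : ℂ) * B := by
      rcases lt_or_ge ‖(M : ℝ) • (x - x₀) - e‖ (1 / 2) with h | h
      · rw [hB x h]
      · rw [mollifier_eq_zero h]; simp
    change (((M : ℝ) ^ d * (mollifier d ((M : ℝ) • (x - x₀) - 0) -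
      mollifier d ((M : ℝ) • (x - x₀) - e)) : ℝ) : ℂ) * U x = _
    push_cast
    linear_combination (M : ℂ) ^ d * h2 - (M : ℂ) ^ d * h3
  simp_rw [h1]
  rw [integral_sub ((hint 0).mul_const _) ((hint e).mul_const _), integral_mul_const,
    integral_mul_const, integral_mollifier_comp M hM, integral_mollifier_comp M hM, one_mul, one_mul]

theorem not_memH_flow (hd : 1 ≤ d) {lam σ t : ℝ} (hlam : lam ≠ 0) (ht : 0 < t)
    {v : Space d → ℝ}
    (hv : ∀ K : ℝ, 0 < K → ∃ (M : ℝˣ) (x₀ : Space d) (h a : ℝ), (0 : ℝ) < M ∧ 0 < h ∧ 0 < a ∧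
        a ≤ 1 ∧ 0 < (h + a) ^ (2 * σ) - h ^ (2 * σ) ∧ (h + a) ^ (2 * σ) - h ^ (2 * σ) ≤ 1 / K ∧
        K ≤ h * ((h + a) ^ (2 * σ) - h ^ (2 * σ)) ∧
        (∀ x, ‖(M : ℝ) • (x - x₀)‖ < 1 / 2 → v x = h + a) ∧
        ∀ x, ‖(M : ℝ) • (x - x₀) - (3 : ℝ) • unitVec hd‖ < 1 / 2 → v x = h)
    {c : Space d} {κ : ℂ} (hκ : ‖κ‖ = 1) {u : Distr d}
    (hu : ∀ φ : 𝓓((⊤ : Opens (Space d)), ℝ),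
      u φ = ∫ x, ((φ x : ℝ) : ℂ) * (κ * flow lam σ t (v (x + c)))) :
    ¬ MemH ((d : ℝ) / 2) u := by
  rintro ⟨T, hTu, hT⟩
  obtain ⟨A, hA⟩ := exists_norm_fourier_sub_translate_le
    (realToSchwartz (mollifier d) contDiff_mollifier hasCompactSupport_mollifier)
    ((3 : ℝ) • unitVec hd)
  obtain ⟨C, hC⟩ := exists_norm_apply_dilate_le hd hA hT
  have hlt : 0 < |lam| * t := mul_pos (abs_pos.2 hlam) ht
  -- The three entries give positivity of `K`, a phase gap of at most `π`, and a jump of at least `C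
  -- + 1`, which exceeds the dual bound `C`.
  set K : ℝ := max (max 1 (|lam| * t / Real.pi)) ((C + 2) / (2 / Real.pi * (|lam| * t))) with hK
  have hK0 : 0 < K := lt_of_lt_of_le one_pos ((le_max_left _ _).trans (le_max_left _ _))
  obtain ⟨M, x₀, h, a, hM, hh, ha, ha1, hD, hDK, hhD, hvA, hvB⟩ := hv K hK0
  have h1 := le_norm_flow_sub_flow (lam := lam) hh ha ha1 ht hK0 (by
    have : |lam| * t / Real.pi ≤ K := (le_max_right _ _).trans (le_max_left _ _)
    rwa [div_le_iff₀' Real.pi_pos] at this) hD hDK hhD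
  have h2 : C + 2 ≤ 2 / Real.pi * (|lam| * t) * K := by
    have : (C + 2) / (2 / Real.pi * (|lam| * t)) ≤ K := le_max_right _ _
    rwa [div_le_iff₀' (by positivity)] at this
  have h3 : u (dipole M (x₀ - c) ((3 : ℝ) • unitVec hd)) =
      κ * flow lam σ t ((h + a : ℝ) : ℂ) - κ * flow lam σ t (h : ℂ) := by
    rw [hu]
    refine integral_dipole_mul hM (fun x hx => ?_) (fun x hx => ?_)
    · rw [hvA]
      rwa [show x + c - x₀ = x - (x₀ - c) by abel]
    · rw [hvB]
      rwa [show x + c - x₀ = x - (x₀ - c) by abel]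
  have h4 := hC M hM (x₀ - c)
  rw [← testToSchwartz_dipole, ← hTu, h3, ← mul_sub, norm_mul, hκ, one_mul] at h4
  linarith


/-! ### Continuous curves of distributions given by continuous functions -/

/-- On a fixed compact set the pairing involves the test function only through its supremum norm, so
it is jointly continuous in the function and the time by dominated convergence. -/
theorem continuous_integral_restrict {U : ℝ≥0 × Space d → ℂ} (hU : Continuous U)
    {K : Set (Space d)} (hK : IsCompact K) :
    Continuous fun p : BoundedContinuousFunction (Space d) ℝ × ℝ≥0 =>
      ∫ x in K, ((p.1 x : ℝ) : ℂ) * U (p.2, x) := by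
  have hcont : Continuous fun q : (BoundedContinuousFunction (Space d) ℝ × ℝ≥0) × Space d =>
      ((q.1.1 q.2 : ℝ) : ℂ) * U (q.1.2, q.2) := by
    refine (Complex.continuous_ofReal.comp ?_).mul (hU.comp (by fun_prop))
    exact continuous_fst.fst.eval continuous_snd
  rw [continuous_iff_continuousAt]
  rintro ⟨f₀, t₀⟩
  obtain ⟨C, hC⟩ := ((isCompact_Icc (a := (0 : ℝ≥0)) (b := t₀ + 1)).prod hK).exists_bound_of_continuousOn
    hU.continuousOn
  refine continuousAt_of_dominated (bound := fun _ => (‖f₀‖ + 1) * C)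
    (.of_forall fun p => (hcont.comp (Continuous.prodMk_right p)).aestronglyMeasurable) ?_
    (integrableOn_const hK.measure_ne_top)
    (.of_forall fun x => (hcont.comp (Continuous.prodMk_left x)).continuousAt)
  have h1 : ∀ᶠ p : BoundedContinuousFunction (Space d) ℝ × ℝ≥0 in 𝓝 (f₀, t₀), ‖p.1‖ < ‖f₀‖ + 1 :=
    (continuous_fst.norm.tendsto (f₀, t₀)).eventually_lt_const (by simp)
  have h2 : ∀ᶠ p : BoundedContinuousFunction (Space d) ℝ × ℝ≥0 in 𝓝 (f₀, t₀), p.2 < t₀ + 1 :=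
    (continuous_snd.tendsto (f₀, t₀)).eventually_lt_const (by simp)
  filter_upwards [h1, h2] with p hp1 hp2
  refine (ae_restrict_iff' hK.measurableSet).2 (.of_forall fun x hx => ?_)
  rw [norm_mul, Complex.norm_real]
  gcongr
  · exact (p.1.norm_coe_le_norm x).trans hp1.le
  · exact hC (p.2, x) ⟨⟨zero_le, hp2.le⟩, hx⟩

theorem continuous_integral_ofSupportedIn {U : ℝ≥0 × Space d → ℂ} (hU : Continuous U)
    (K : Compacts (Space d)) (hK : (K : Set (Space d)) ⊆ (⊤ : Opens (Space d))) :
    Continuous fun p : ContDiffMapSupportedIn (Space d) ℝ ⊤ K × ℝ≥0 =>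
      ∫ x, ((TestFunction.ofSupportedIn hK p.1 x : ℝ) : ℂ) * U (p.2, x) := by
  have h := (continuous_integral_restrict hU K.isCompact).comp
    (((ContDiffMapSupportedIn.toBoundedContinuousFunctionCLM ℝ
      (E := Space d) (F := ℝ) (n := ⊤) (K := K)).continuous).prodMap continuous_id)
  refine h.congr fun p => ?_
  refine setIntegral_eq_integral_of_forall_compl_eq_zero fun x hx => ?_
  have : p.1 x = 0 := p.1.zero_on_compl hx
  simp [this]

theorem integrable_test_mul {U : Space d → ℂ} (hU : LocallyIntegrable U)
    (φ : 𝓓((⊤ : Opens (Space d)), ℝ)) : Integrable fun x => ((φ x : ℝ) : ℂ) * U x := by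
  refine (hU.integrable_smul_left_of_hasCompactSupport φ.continuous φ.hasCompactSupport).congr
    (.of_forall fun x => ?_)
  simp

/-- The pairing of a continuous function on space-time with a test function on space, as a
function of time. -/
def timePairing (U : ℝ≥0 × Space d → ℂ) (hU : Continuous U) :
    𝓓((⊤ : Opens (Space d)), ℝ) →L[ℝ] C(ℝ≥0, ℂ) :=
  TestFunction.mkCLM ℝ
    (fun φ => ⟨fun t => ∫ x, ((φ x : ℝ) : ℂ) * U (t, x), by
      set K : Compacts (Space d) := ⟨tsupport φ, φ.hasCompactSupport⟩
      have h := continuous_integral_ofSupportedIn hU K (fun _ _ => trivial)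
      exact h.comp (Continuous.prodMk_right
        (ContDiffMapSupportedIn.of_support_subset φ.contDiff subset_closure))⟩)
    (fun φ ψ => by
      ext t
      have hUt : LocallyIntegrable fun x => U (t, x) :=
        (hU.comp (by fun_prop)).locallyIntegrable
      change ∫ x, (((φ + ψ) x : ℝ) : ℂ) * U (t, x) = (∫ x, _) + ∫ x, _
      rw [← integral_add (integrable_test_mul hUt φ) (integrable_test_mul hUt ψ)]
      simp [add_mul])
    (fun c φ => by
      ext t
      change ∫ x, (((c • φ) x : ℝ) : ℂ) * U (t, x) = c • ∫ x, _
      rw [← integral_smul]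
      simp [mul_assoc])
    (fun K hK => ContinuousMap.continuous_of_continuous_uncurry _
      (continuous_integral_ofSupportedIn hU K hK))

/-- A continuous function on space-time defines a continuous curve of distributions. -/
def toDistrCurve (U : ℝ≥0 × Space d → ℂ) (hU : Continuous U) : C(ℝ≥0, Distr d) where
  toFun t := ContinuousLinearMap.toUniformConvergenceCLM (RingHom.id ℝ) ℂ {S | IsCompact S}
    ((ContinuousMap.evalCLM ℝ t) ∘L timePairing U hU)
  continuous_toFun := by
    rw [continuous_iff_continuousAt]
    intro t
    -- The topology on distributions is uniform convergence on compact sets of test functions; joint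
    -- continuity of the pairing together with compactness of `S` yields the uniformity.
    refine (UniformConvergenceCLM.tendsto_iff_tendstoUniformlyOn _ _ _).2 fun S hS => ?_
    have hcont : Continuous fun p : ℝ≥0 × 𝓓((⊤ : Opens (Space d)), ℝ) =>
        timePairing U hU p.2 p.1 := by fun_prop
    intro u hu
    obtain ⟨V, hV, hVu⟩ := IsCompact.mem_uniformity_of_prod (s := univ) (q := t)
      (f := fun s φ => timePairing U hU φ s) hS hcont.continuousOn (mem_univ t) (symm_le_uniformity hu)
    rw [nhdsWithin_univ] at hV
    filter_upwards [hV] with s hs φ hφ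
    exact hVu s hs φ hφ


/-! ### Reduction to an ordinary differential equation along characteristics -/

theorem hasCompactSupport_slice {F : Type*} [Zero F] {Φ : ℝ × Space d → F} (hΦ : HasCompactSupport Φ)
    (t : ℝ) : HasCompactSupport fun x => Φ (t, x) :=
  HasCompactSupport.intro (hΦ.isCompact.image continuous_snd) fun x hx => by
    by_contra h
    exact hx ⟨(t, x), subset_tsupport _ h, rfl⟩

theorem hasCompactSupport_slice' {F : Type*} [Zero F] {Φ : ℝ × Space d → F}
    (hΦ : HasCompactSupport Φ) (x : Space d) : HasCompactSupport fun t => Φ (t, x) :=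
  HasCompactSupport.intro (hΦ.isCompact.image continuous_fst) fun t ht => by
    by_contra h
    exact ht ⟨(t, x), subset_tsupport _ h, rfl⟩

/-- The oscillating factor `e^{i a t}`. -/
def wave (a t : ℝ) : ℂ := Complex.exp (Complex.I * ((a * t : ℝ) : ℂ))

theorem norm_wave (a t : ℝ) : ‖wave a t‖ = 1 := by
  rw [wave, mul_comm, Complex.norm_exp_ofReal_mul_I]

theorem wave_neg_mul_wave (a t : ℝ) : wave (-a) t * wave a t = 1 := by
  rw [wave, wave, ← Complex.exp_add, ← Complex.exp_zero]
  congr 1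
  push_cast
  ring

theorem contDiff_wave (a : ℝ) : ContDiff ℝ ∞ (wave a) := by
  unfold wave
  have h : ContDiff ℝ ∞ fun t : ℝ => ((a * t : ℝ) : ℂ) :=
    Complex.ofRealCLM.contDiff.comp (contDiff_const.mul contDiff_id)
  exact (contDiff_const.mul h).cexp

theorem continuous_wave (a : ℝ) : Continuous (wave a) := (contDiff_wave a).continuous

theorem hasDerivAt_wave (a t : ℝ) : HasDerivAt (wave a) (wave a t * (Complex.I * a)) t := by
  unfold wave
  have h : HasDerivAt (fun t : ℝ => ((a * t : ℝ) : ℂ)) (a : ℂ) t := by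
    have := (((hasDerivAt_id t).const_mul a).ofReal_comp)
    simpa using this
  exact (h.const_mul Complex.I).cexp

/-- The transposed operator is `-i (∂ₜ - c · ∇ + i a)`, that is, differentiation along the
characteristic through `(t, x)` with integrating factor `e^{iat}`. -/
theorem transport_eq_deriv {P : Space d → ℝ} {c : Space d} {a : ℝ}
    (hP : ∀ ξ, P ξ = inner ℝ c ξ + a) {Φ : ℝ × Space d → ℂ} (hΦ : ContDiff ℝ ∞ Φ)
    (hΦc : HasCompactSupport Φ) (z : ℂ) (t : ℝ) (x : Space d) :
    -(Complex.I * z * deriv (fun s => Φ (s, x)) t) +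
        z * multTranspose P (fun y => Φ (t, y)) x =
      -Complex.I * (wave (-a) t * z) *
        deriv (fun s => wave a s * Φ (s, x + t • c - s • c)) t := by
  have hslice : ContDiff ℝ ∞ fun y => Φ (t, y) := hΦ.comp (by fun_prop)
  have hm := multTranspose_affine hP ((hasCompactSupport_slice hΦc t).toSchwartzMap hslice) x
  have hcoe : (((hasCompactSupport_slice hΦc t).toSchwartzMap hslice : 𝓢(Space d, ℂ)) :
      Space d → ℂ) = fun y => Φ (t, y) := rfl
  rw [hcoe] at hm
  have hd : HasFDerivAt Φ (fderiv ℝ Φ (t, x)) (t, x) :=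
    (hΦ.differentiable (by simp)).differentiableAt.hasFDerivAt
  have h1 : HasDerivAt (fun s => Φ (s, x)) (fderiv ℝ Φ (t, x) (1, 0)) t := by
    have := hd.comp_hasDerivAt t ((hasDerivAt_id t).prodMk (hasDerivAt_const t x))
    exact this
  have h2 : fderiv ℝ (fun y => Φ (t, y)) x c = fderiv ℝ Φ (t, x) (0, c) := by
    have := hd.comp x ((hasFDerivAt_const t x).prodMk (hasFDerivAt_id x))
    rw [HasFDerivAt.fderiv (f := fun y => Φ (t, y)) this]
    simp
  have h3 : HasDerivAt (fun s => Φ (s, x + t • c - s • c)) (fderiv ℝ Φ (t, x) (1, -c)) t := by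
    have hd' : HasFDerivAt Φ (fderiv ℝ Φ (t, x)) (t, x + t • c - t • c) := by
      rwa [add_sub_cancel_right]
    have hl : HasDerivAt (fun s : ℝ => x + t • c - s • c) (-c) t := by
      simpa using ((hasDerivAt_id t).smul_const c).const_sub (x + t • c)
    exact hd'.comp_hasDerivAt t ((hasDerivAt_id t).prodMk hl)
  have h4 : fderiv ℝ Φ (t, x) (1, -c) = fderiv ℝ Φ (t, x) (1, 0) - fderiv ℝ Φ (t, x) (0, c) := by
    rw [← map_sub]; simp
  have h5 : HasDerivAt (fun s => wave a s * Φ (s, x + t • c - s • c)) _ t :=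
    (hasDerivAt_wave a t).mul h3
  rw [hm, h1.deriv, h5.deriv, h2, h4, add_sub_cancel_right]
  linear_combination
    (z * (-Complex.I * (fderiv ℝ Φ (t, x) (1, 0) - fderiv ℝ Φ (t, x) (0, c)) + a * Φ (t, x))) *
      (-wave_neg_mul_wave a t) +
    wave (-a) t * wave a t * z * a * Φ (t, x) * Complex.I_sq

/-- The shear `(t, x) ↦ (t, x + t c)` of space-time. -/
def shear (c : Space d) : (ℝ × Space d) ≃ₜ (ℝ × Space d) where
  toFun p := (p.1, p.2 + p.1 • c)
  invFun p := (p.1, p.2 - p.1 • c)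
  left_inv p := by simp
  right_inv p := by simp
  continuous_toFun := by fun_prop
  continuous_invFun := by fun_prop

theorem shear_apply (c : Space d) (t : ℝ) (x : Space d) : shear c (t, x) = (t, x + t • c) := rfl

theorem shear_symm_apply (c : Space d) (t : ℝ) (x : Space d) :
    (shear c).symm (t, x) = (t, x - t • c) := rfl

theorem shear_symm (c : Space d) : (shear c).symm = shear (-c) := by
  ext1 p
  obtain ⟨t, x⟩ := p
  rw [shear_symm_apply, shear_apply, smul_neg, sub_eq_add_neg]

theorem measurePreserving_shear (c : Space d) :
    MeasurePreserving (shear c) (volume : Measure (ℝ × Space d)) volume := by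
  refine MeasurePreserving.skew_product (f := id) (g := fun t x => x + t • c)
    (MeasurePreserving.id _) (by fun_prop) (.of_forall fun t => ?_)
  exact (measurePreserving_add_right volume (t • c)).map_eq

theorem shear_preimage_spaceTime (c : Space d) :
    shear c ⁻¹' (spaceTime d : Set (ℝ × Space d)) = spaceTime d := by
  ext p
  simp [spaceTime, shear]

theorem setIntegral_comp_shear (c : Space d) (g : ℝ × Space d → ℂ) :
    ∫ p in (spaceTime d : Set (ℝ × Space d)), g (shear c p) =
      ∫ p in (spaceTime d : Set (ℝ × Space d)), g p := by
  have h := (measurePreserving_shear c).setIntegral_preimage_emb (shear c).measurableEmbedding g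
    (spaceTime d : Set (ℝ × Space d))
  rwa [shear_preimage_spaceTime] at h

theorem locallyIntegrableOn_comp_shear (c : Space d) {g : ℝ × Space d → ℂ}
    (hg : LocallyIntegrableOn g (spaceTime d)) :
    LocallyIntegrableOn (fun p => g (shear c p)) (spaceTime d) := by
  rw [locallyIntegrableOn_iff (spaceTime d).isOpen.isLocallyClosed] at hg ⊢
  intro K hK hKc
  have h1 := hg (shear c '' K) (by
    rw [image_subset_iff, shear_preimage_spaceTime]; exact hK)
    (hKc.image (shear c).continuous)
  have h2 := ((measurePreserving_shear c).integrableOn_comp_preimage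
    (shear c).measurableEmbedding).2 h1
  rwa [(shear c).injective.preimage_image] at h2

/-! ### The solution -/

theorem continuous_flow {X : Type*} [TopologicalSpace X] {lam σ : ℝ} (hσ : 0 < σ) {t : X → ℝ}
    {z : X → ℂ} (ht : Continuous t) (hz : Continuous z) :
    Continuous fun x => flow lam σ (t x) (z x) := by
  have h : Continuous fun x => ‖z x‖ ^ (2 * σ) :=
    hz.norm.rpow_const fun _ => Or.inr (by positivity)
  unfold flow
  fun_prop

theorem hasDerivAt_flow (lam σ t : ℝ) (z : ℂ) :
    HasDerivAt (fun s => flow lam σ s z)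
      (-Complex.I * lam * nonlin σ (flow lam σ t z)) t := by
  rw [nonlin_flow]
  have h := (hasDerivAt_wave (-(lam * ‖z‖ ^ (2 * σ))) t).mul_const z
  refine (h.congr_deriv ?_).congr_of_eventuallyEq (.of_forall fun s => ?_)
  · simp only [flow, wave]
    push_cast
    ring_nf
  · simp only [flow, wave]
    congr 3
    push_cast
    ring

theorem nonlin_mul_of_norm_one (σ : ℝ) {w : ℂ} (hw : ‖w‖ = 1) (z : ℂ) :
    nonlin σ (w * z) = w * nonlin σ z := by
  rw [nonlin, nonlin, norm_mul, hw, one_mul]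
  ring

theorem continuous_nonlin {σ : ℝ} (hσ : 0 < σ) : Continuous (nonlin σ) := by
  have h : Continuous fun z : ℂ => ‖z‖ ^ (2 * σ) :=
    continuous_norm.rpow_const fun _ => Or.inr (by positivity)
  unfold nonlin
  fun_prop

/-- The solution with datum `v`, as a function on space-time. -/
def evolution (c : Space d) (a lam σ : ℝ) (v : Space d → ℝ) (p : ℝ × Space d) : ℂ :=
  wave a p.1 * flow lam σ p.1 (v (p.2 + p.1 • c))

theorem continuous_evolution (c : Space d) (a lam : ℝ) {σ : ℝ} (hσ : 0 < σ) {v : Space d → ℝ}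
    (hv : Continuous v) : Continuous (evolution c a lam σ v) := by
  unfold evolution
  have h := continuous_flow (lam := lam) hσ (t := fun p : ℝ × Space d => p.1)
    (z := fun p : ℝ × Space d => ((v (p.2 + p.1 • c) : ℝ) : ℂ)) continuous_fst (by fun_prop)
  exact ((continuous_wave a).comp continuous_fst).mul h

/-- The conjugation of test functions which straightens the characteristics. -/
theorem contDiff_straighten (c : Space d) (a : ℝ) {Φ : ℝ × Space d → ℂ} (hΦ : ContDiff ℝ ∞ Φ) :
    ContDiff ℝ ∞ fun p : ℝ × Space d => wave a p.1 * Φ (p.1, p.2 - p.1 • c) :=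
  ((contDiff_wave a).comp contDiff_fst).mul (hΦ.comp (by fun_prop))

theorem hasCompactSupport_straighten (c : Space d) (a : ℝ) {Φ : ℝ × Space d → ℂ}
    (hΦ : HasCompactSupport Φ) :
    HasCompactSupport fun p : ℝ × Space d => wave a p.1 * Φ (p.1, p.2 - p.1 • c) :=
  HasCompactSupport.mul_left (hΦ.comp_homeomorph (shear c).symm)

/-- After the shear, the difference of the two integrands is the exact `t`-derivative of `-i V Θ` at
fixed `y`, so integrating in `t` first gives zero. Only continuity of `v` in space is needed. -/
theorem evolution_equation {P : Space d → ℝ} {c : Space d} {a : ℝ}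
    (hP : ∀ ξ, P ξ = inner ℝ c ξ + a) (lam : ℝ) {σ : ℝ} (hσ : 0 < σ) {v : Space d → ℝ}
    (hv : Continuous v) (Φ : 𝓓(spaceTime d, ℂ)) :
    ∫ p in (spaceTime d : Set (ℝ × Space d)),
        (-(Complex.I * evolution c a lam σ v p * deriv (fun s => Φ (s, p.2)) p.1)
          + evolution c a lam σ v p * multTranspose P (fun x => Φ (p.1, x)) p.2) =
      ∫ p in (spaceTime d : Set (ℝ × Space d)), (lam : ℂ) * nonlin σ (evolution c a lam σ v p) * Φ p := by
  set Θ : ℝ × Space d → ℂ := fun p => wave a p.1 * Φ (p.1, p.2 - p.1 • c) with hΘ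
  have hΘd : ContDiff ℝ ∞ Θ := contDiff_straighten c a Φ.contDiff
  have hΘc : HasCompactSupport Θ := hasCompactSupport_straighten c a Φ.hasCompactSupport
  have hΘ0 : ∀ p ∉ (spaceTime d : Set (ℝ × Space d)), p ∉ tsupport Θ := by
    intro p hp hpΘ
    have h1 : tsupport Θ ⊆ (shear c).symm ⁻¹' tsupport Φ := by
      refine closure_minimal (fun q hq => ?_)
        ((isClosed_tsupport _).preimage (shear c).symm.continuous)
      exact subset_tsupport _ (right_ne_zero_of_mul hq)
    have h2 := Φ.tsupport_subset (h1 hpΘ)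
    rw [shear_symm] at h2
    have h3 : p ∈ shear (-c) ⁻¹' (spaceTime d : Set (ℝ × Space d)) := h2
    rw [shear_preimage_spaceTime] at h3
    exact hp h3
  set V : ℝ × Space d → ℂ := fun p => flow lam σ p.1 (v p.2) with hV
  have hVc : Continuous V := continuous_flow hσ continuous_fst (by fun_prop)
  have hder : ∀ t y, HasDerivAt (fun s => Θ (s, y)) (fderiv ℝ Θ (t, y) (1, 0)) t := fun t y =>
    (hΘd.differentiable (by simp)).differentiableAt.hasFDerivAt.comp_hasDerivAt t
      ((hasDerivAt_id t).prodMk (hasDerivAt_const t y))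
  set g : ℝ × Space d → ℂ := fun p => -Complex.I * V p * fderiv ℝ Θ p (1, 0) with hg
  set k : ℝ × Space d → ℂ := fun p => (lam : ℂ) * nonlin σ (V p) * Θ p with hk
  have hcancel : ∀ p, wave (-a) p.1 * evolution c a lam σ v p = V (shear c p) := by
    rintro ⟨t, x⟩
    rw [evolution, ← mul_assoc, wave_neg_mul_wave, one_mul]
    rfl
  have hleft : ∀ p : ℝ × Space d,
      -(Complex.I * evolution c a lam σ v p * deriv (fun s => Φ (s, p.2)) p.1)
          + evolution c a lam σ v p * multTranspose P (fun x => Φ (p.1, x)) p.2 = g (shear c p) := by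
    rintro ⟨t, x⟩
    rw [transport_eq_deriv hP Φ.contDiff Φ.hasCompactSupport, hcancel (t, x)]
    rw [(hder t (x + t • c)).deriv]
    rfl
  have hright : ∀ p : ℝ × Space d,
      (lam : ℂ) * nonlin σ (evolution c a lam σ v p) * Φ p = k (shear c p) := by
    rintro ⟨t, x⟩
    have h1 : evolution c a lam σ v (t, x) = wave a t * V (shear c (t, x)) := rfl
    have h2 : Θ (shear c (t, x)) = wave a t * Φ (t, x) := by
      simp [hΘ, shear_apply]
    simp only [hk]
    rw [h1, h2, nonlin_mul_of_norm_one σ (norm_wave a t)]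
    ring
  simp_rw [hleft, hright]
  rw [setIntegral_comp_shear, setIntegral_comp_shear]
  have hfd : Continuous fun p => fderiv ℝ Θ p (1, 0) :=
    (hΘd.continuous_fderiv (by simp)).clm_apply continuous_const
  have hfdc : HasCompactSupport fun p => fderiv ℝ Θ p (1, 0) := hΘc.fderiv_apply ℝ (1, 0)
  have hgc : Continuous g := (continuous_const.mul hVc).mul hfd
  have hgs : HasCompactSupport g := hfdc.mul_left
  have hkc : Continuous k :=
    (continuous_const.mul ((continuous_nonlin hσ).comp hVc)).mul hΘd.continuous
  have hks : HasCompactSupport k := hΘc.mul_left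
  have hVΘ : HasCompactSupport fun p => V p * Θ p := hΘc.mul_left
  have hgi : Integrable g := hgc.integrable_of_hasCompactSupport hgs
  have hki : Integrable k := hkc.integrable_of_hasCompactSupport hks
  rw [setIntegral_eq_integral_of_forall_compl_eq_zero, setIntegral_eq_integral_of_forall_compl_eq_zero,
    ← sub_eq_zero, ← integral_sub hgi hki]
  · have hsub : Integrable fun p => g p - k p := hgi.sub hki
    rw [Measure.volume_eq_prod] at hsub ⊢
    rw [integral_prod_symm _ hsub]
    refine integral_eq_zero_of_ae (.of_forall fun y => ?_)
    have hd : ∀ t, HasDerivAt (fun s => -Complex.I * (V (s, y) * Θ (s, y)))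
        (g (t, y) - k (t, y)) t := by
      intro t
      refine (((hasDerivAt_flow lam σ t (v y)).mul (hder t y)).const_mul (-Complex.I)).congr_deriv ?_
      simp only [hg, hk, hV]
      linear_combination (lam * nonlin σ (flow lam σ t (v y)) * Θ (t, y)) * Complex.I_sq
    have hc1 : Continuous fun t : ℝ => (t, y) := by fun_prop
    refine integral_eq_zero_of_hasDerivAt_of_integrable hd ?_ ?_
    · exact ((hgc.comp hc1).sub (hkc.comp hc1)).integrable_of_hasCompactSupport
        ((hasCompactSupport_slice' hgs y).sub (hasCompactSupport_slice' hks y))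
    · have h1 : Continuous fun t => V (t, y) * Θ (t, y) := (hVc.comp hc1).mul (hΘd.continuous.comp hc1)
      exact (h1.integrable_of_hasCompactSupport (hasCompactSupport_slice' hVΘ y)).const_mul _
  · intro p hp
    simp only [hk, image_eq_zero_of_notMem_tsupport (hΘ0 p hp), mul_zero]
  · intro p hp
    have : p ∉ tsupport (fderiv ℝ Θ) := fun h => hΘ0 p hp (tsupport_fderiv_subset ℝ h)
    simp [hg, image_eq_zero_of_notMem_tsupport this]


/-! ### Weak solutions of an ordinary differential equation -/

/-- The point `1` is included because primitives on the half line are based there; it also covers an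
empty `K`. -/
theorem exists_Ioo_superset {K : Set ℝ} (hK : IsCompact K) (hK0 : K ⊆ Ioi 0) :
    ∃ p q : ℝ, 0 < p ∧ p ≤ 1 ∧ 1 ≤ q ∧ K ⊆ Ioo p q := by
  have hK' : IsCompact (insert 1 K) := hK.insert 1
  have hne : (insert (1 : ℝ) K).Nonempty := insert_nonempty _ _
  obtain ⟨p, hp, hpm⟩ := hK'.exists_isLeast hne
  obtain ⟨q, hq, hqm⟩ := hK'.exists_isGreatest hne
  have hp0 : 0 < p := by
    rcases hp with rfl | hp
    · exact one_pos
    · exact hK0 hp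
  have h1 := hpm (mem_insert 1 K)
  have h2 := hqm (mem_insert 1 K)
  refine ⟨p / 2, q + 1, by linarith, by linarith, by linarith, fun t ht => ?_⟩
  have h3 := hpm (mem_insert_of_mem 1 ht)
  have h4 := hqm (mem_insert_of_mem 1 ht)
  exact ⟨by linarith, by linarith⟩

theorem integrable_smul_of_tsupport_subset {E : Type*} [NormedAddCommGroup E] [NormedSpace ℝ E]
    {f : ℝ → E} {s : Set ℝ} (hs : IsOpen s) (hf : LocallyIntegrableOn f s) {η : ℝ → ℝ}
    (hη : Continuous η) (hηc : HasCompactSupport η) (hηs : tsupport η ⊆ s) :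
    Integrable fun t => η t • f t := by
  have h1 : IntegrableOn f (tsupport η) :=
    (locallyIntegrableOn_iff hs.isLocallyClosed).1 hf _ hηs hηc
  have h2 : IntegrableOn (fun t => η t • f t) (tsupport η) :=
    h1.continuousOn_smul hη.continuousOn hηc
  rw [← integrableOn_univ]
  refine h2.of_forall_sdiff_eq_zero MeasurableSet.univ fun t ht => ?_
  rw [image_eq_zero_of_notMem_tsupport ht.2, zero_smul]

theorem exists_bump_Ioi : ∃ η : ℝ → ℝ, ContDiff ℝ ∞ η ∧ HasCompactSupport η ∧
    tsupport η ⊆ Ioi 0 ∧ ∫ t, η t = 1 := by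
  let b : ContDiffBump (2 : ℝ) := ⟨1 / 2, 1, by norm_num, by norm_num⟩
  refine ⟨b.normed volume, b.contDiff_normed, b.hasCompactSupport_normed, ?_, b.integral_normed⟩
  rw [b.tsupport_normed_eq]
  intro t ht
  rw [Metric.mem_closedBall, Real.dist_eq, abs_le] at ht
  have h1 : b.rOut = 1 := rfl
  rw [h1] at ht
  simp only [mem_Ioi]
  linarith [ht.1]

/-- A test function on `(0, ∞)` with vanishing integral is the derivative of a test function. -/
theorem exists_primitive_test {h : ℝ → ℝ} (hh : ContDiff ℝ ∞ h) (hhc : HasCompactSupport h)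
    (hh0 : tsupport h ⊆ Ioi 0) (hint : ∫ t, h t = 0) :
    ∃ η : ℝ → ℝ, ContDiff ℝ ∞ η ∧ HasCompactSupport η ∧ tsupport η ⊆ Ioi 0 ∧ deriv η = h := by
  obtain ⟨p, q, hp, hp1, hq1, hpq⟩ := exists_Ioo_superset hhc hh0
  have hder : ∀ t, HasDerivAt (fun t => ∫ s in p..t, h s) (h t) t := fun t =>
    intervalIntegral.integral_hasDerivAt_right (hh.continuous.intervalIntegrable _ _)
      hh.continuous.stronglyMeasurable.stronglyMeasurableAtFilter hh.continuous.continuousAt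
  have hderiv : deriv (fun t => ∫ s in p..t, h s) = h := funext fun t => (hder t).deriv
  have hsupp : ∀ t ∉ Icc p q, ∫ s in p..t, h s = 0 := by
    intro t ht
    rcases lt_or_ge t p with htp | htp
    · rw [intervalIntegral.integral_congr (g := fun _ => (0 : ℝ))]
      · simp
      · intro s hs
        rw [uIcc_of_ge htp.le] at hs
        refine image_eq_zero_of_notMem_tsupport fun hs' => ?_
        exact absurd (hpq hs').1 (not_lt.2 hs.2)
    · have htq : q < t := by
        by_contra hc
        exact ht ⟨htp, not_lt.1 hc⟩
      rw [intervalIntegral.integral_of_le htp, ← hint]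
      refine setIntegral_eq_integral_of_forall_compl_eq_zero fun s hs => ?_
      refine image_eq_zero_of_notMem_tsupport fun hs' => hs ?_
      exact ⟨(hpq hs').1, (hpq hs').2.le.trans htq.le⟩
  have hts : tsupport (fun t => ∫ s in p..t, h s) ⊆ Icc p q :=
    closure_minimal (fun t ht => by_contra fun hc => ht (hsupp t hc)) isClosed_Icc
  refine ⟨fun t => ∫ s in p..t, h s, ?_, HasCompactSupport.intro isCompact_Icc hsupp,
    hts.trans fun t ht => hp.trans_le ht.1, hderiv⟩
  rw [contDiff_infty_iff_deriv, hderiv]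
  exact ⟨fun t => (hder t).differentiableAt, hh⟩

/-- The lemma of du Bois-Reymond on the half line. -/
theorem ae_eq_const_of_integral_deriv_eq_zero {f : ℝ → ℝ} (hf : LocallyIntegrableOn f (Ioi 0))
    (h : ∀ η : ℝ → ℝ, ContDiff ℝ ∞ η → HasCompactSupport η → tsupport η ⊆ Ioi 0 →
      ∫ t, deriv η t * f t = 0) :
    ∃ C : ℝ, ∀ᵐ t, 0 < t → f t = C := by
  obtain ⟨η₀, hη₀, hη₀c, hη₀s, hη₀i⟩ := exists_bump_Ioi
  refine ⟨∫ t, η₀ t * f t, ?_⟩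
  have hconst : LocallyIntegrableOn (fun _ : ℝ => ∫ t, η₀ t * f t) (Ioi 0) :=
    (locallyIntegrable_const _).locallyIntegrableOn _
  have key := isOpen_Ioi.ae_eq_zero_of_integral_contDiff_smul_eq_zero (hf.sub hconst) ?_
  · filter_upwards [key] with t ht h0
    have := ht h0
    simpa [sub_eq_zero] using this
  intro g hg hgc hgs
  set A : ℝ := ∫ t, g t with hA
  have hgi : Integrable g := hg.continuous.integrable_of_hasCompactSupport hgc
  have hη₀int : Integrable η₀ := hη₀.continuous.integrable_of_hasCompactSupport hη₀c
  have hgf : Integrable fun t => g t * f t :=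
    integrable_smul_of_tsupport_subset isOpen_Ioi hf hg.continuous hgc hgs
  have hηf : Integrable fun t => η₀ t * f t :=
    integrable_smul_of_tsupport_subset isOpen_Ioi hf hη₀.continuous hη₀c hη₀s
  -- Subtracting the multiple of `η₀` with the same integral leaves a test function of mean zero,
  -- hence an admissible derivative.
  obtain ⟨η, hη, hηc, hηs, hηd⟩ := exists_primitive_test (h := fun t => g t - A * η₀ t)
    (hg.sub (contDiff_const.mul hη₀)) (hgc.sub hη₀c.mul_left)
    ((tsupport_sub _ _).trans (union_subset hgs
      ((closure_mono (Function.support_mul_subset_right _ _)).trans hη₀s))) (by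
      rw [integral_sub hgi (hη₀int.const_mul A), integral_const_mul, hη₀i, mul_one, sub_self])
  have h1 := h η hη hηc hηs
  rw [hηd] at h1
  have h2 : ∀ t, (g t - A * η₀ t) * f t = g t * f t - A * (η₀ t * f t) := fun t => by ring
  simp_rw [h2] at h1
  rw [integral_sub hgf (hηf.const_mul A), integral_const_mul] at h1
  have h3 : ∀ t, g t • (f - fun _ : ℝ => ∫ t, η₀ t * f t) t =
      g t * f t - g t * ∫ t, η₀ t * f t := fun t => by
    simp [mul_sub]
  simp_rw [h3]
  rw [integral_sub hgf (hgi.mul_const _), integral_mul_const]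
  exact h1

theorem intervalIntegrable_of_locallyIntegrableOn_Ioi {E : Type*} [NormedAddCommGroup E]
    {g : ℝ → E} (hg : LocallyIntegrableOn g (Ioi 0)) {p q : ℝ} (hp : 0 < p) (hq : 0 < q) :
    IntervalIntegrable g volume p q := by
  have h : IntegrableOn g (uIcc p q) :=
    (locallyIntegrableOn_iff isOpen_Ioi.isLocallyClosed).1 hg _
      (fun t ht => lt_of_lt_of_le (lt_min hp hq) ht.1) isCompact_uIcc
  exact (intervalIntegrable_iff).2 (h.mono_set uIoc_subset_uIcc)

theorem continuousOn_primitive_Ioi {E : Type*} [NormedAddCommGroup E] [NormedSpace ℝ E]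
    {g : ℝ → E} (hg : LocallyIntegrableOn g (Ioi 0)) :
    ContinuousOn (fun t => ∫ s in (1 : ℝ)..t, g s) (Ioi 0) := by
  intro t ht
  have ht0 : (0 : ℝ) < t := ht
  have hI : IntegrableOn g (uIcc (min 1 (t / 2)) (t + 1)) := by
    refine (locallyIntegrableOn_iff isOpen_Ioi.isLocallyClosed).1 hg _ (fun s hs => ?_)
      isCompact_uIcc
    exact lt_of_lt_of_le (lt_min (lt_min one_pos (by linarith)) (by linarith)) hs.1
  have hle : min 1 (t / 2) ≤ t + 1 := (min_le_left _ _).trans (by linarith)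
  have h1 := intervalIntegral.continuousOn_primitive_interval' (b₁ := min 1 (t / 2))
    (b₂ := t + 1) (a := 1) (μ := volume) (f := g)
    ((intervalIntegrable_iff).2 (hI.mono_set uIoc_subset_uIcc))
    (by rw [uIcc_of_le hle]; exact ⟨min_le_left _ _, by linarith⟩)
  rw [uIcc_of_le hle] at h1
  refine (h1.continuousAt (Icc_mem_nhds ?_ (by linarith))).continuousWithinAt
  exact (min_le_right _ _).trans_lt (by linarith)

/-- The primitive of `g` has the same weak derivative as `f`, so their difference falls under the
lemma of du Bois-Reymond. -/
theorem ae_eq_primitive_of_weak_deriv {f g : ℝ → ℝ} (hf : LocallyIntegrableOn f (Ioi 0))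
    (hg : LocallyIntegrableOn g (Ioi 0))
    (h : ∀ η : ℝ → ℝ, ContDiff ℝ ∞ η → HasCompactSupport η → tsupport η ⊆ Ioi 0 →
      ∫ t, (deriv η t * f t + η t * g t) = 0) :
    ∃ C : ℝ, ∀ᵐ t, 0 < t → f t = C + ∫ s in (1 : ℝ)..t, g s := by
  have hF : LocallyIntegrableOn (fun t => ∫ s in (1 : ℝ)..t, g s) (Ioi 0) :=
    (continuousOn_primitive_Ioi hg).locallyIntegrableOn measurableSet_Ioi
  suffices key : ∀ η : ℝ → ℝ, ContDiff ℝ ∞ η → HasCompactSupport η → tsupport η ⊆ Ioi 0 →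
      ∫ t, deriv η t * (f - fun t => ∫ s in (1 : ℝ)..t, g s) t = 0 by
    obtain ⟨C, hC⟩ := ae_eq_const_of_integral_deriv_eq_zero (hf.sub hF) key
    refine ⟨C, ?_⟩
    filter_upwards [hC] with t ht h0
    have := ht h0
    simp only [Pi.sub_apply] at this
    linarith
  intro η hη hηc hηs
  have hdc : Continuous (deriv η) := hη.continuous_deriv (by simp)
  have hdcs : HasCompactSupport (deriv η) := hηc.deriv
  have hds : tsupport (deriv η) ⊆ Ioi 0 := (tsupport_deriv_subset).trans hηs
  have i1 : Integrable fun t => deriv η t * f t :=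
    integrable_smul_of_tsupport_subset isOpen_Ioi hf hdc hdcs hds
  have i2 : Integrable fun t => η t * g t :=
    integrable_smul_of_tsupport_subset isOpen_Ioi hg hη.continuous hηc hηs
  have i3 : Integrable fun t => deriv η t * ∫ s in (1 : ℝ)..t, g s :=
    integrable_smul_of_tsupport_subset isOpen_Ioi hF hdc hdcs hds
  -- Since `g` is only locally integrable, its primitive is merely absolutely continuous, and
  -- integration by parts is used in that class.
  have hparts : ∫ t, (deriv η t * (∫ s in (1 : ℝ)..t, g s) + η t * g t) = 0 := by
    obtain ⟨p, q, hp, hp1, hq1, hpq⟩ := exists_Ioo_superset hηc hηs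
    have hle : p ≤ q := hp1.trans hq1
    have hout : ∀ t ∉ Ioo p q, η t = 0 := fun t ht =>
      image_eq_zero_of_notMem_tsupport fun h' => ht (hpq h')
    have hout' : ∀ t ∉ Ioo p q, deriv η t = 0 := fun t ht =>
      image_eq_zero_of_notMem_tsupport fun h' => ht (hpq (tsupport_deriv_subset h'))
    have hgI := intervalIntegrable_of_locallyIntegrableOn_Ioi hg hp (one_pos.trans_le hq1)
    have h1mem : (1 : ℝ) ∈ uIcc p q := by rw [uIcc_of_le hle]; exact ⟨hp1, hq1⟩
    have hAC := hgI.absolutelyContinuousOnInterval_intervalIntegral h1mem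
    have hηAC : AbsolutelyContinuousOnInterval η p q :=
      ((hη.of_le (by simp)).contDiffOn).absolutelyContinuousOnInterval
    have hp' := hηAC.integral_deriv_mul_eq_sub hAC
    rw [hout p (by simp), hout q (by simp), zero_mul, zero_mul, sub_zero] at hp'
    rw [← hp', intervalIntegral.integral_of_le hle,
      ← setIntegral_eq_integral_of_forall_compl_eq_zero (s := Ioc p q)]
    · refine setIntegral_congr_ae measurableSet_Ioc ?_
      filter_upwards [hgI.ae_hasDerivAt_integral] with t ht htm
      rw [(ht (by rw [uIcc_of_le hle]; exact Ioc_subset_Icc_self htm) 1 h1mem).deriv]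
    · intro t ht
      have ht' : t ∉ Ioo p q := fun h' => ht (Ioo_subset_Ioc_self h')
      rw [hout t ht', hout' t ht', zero_mul, zero_mul, add_zero]
  have h1 := h η hη hηc hηs
  rw [integral_add i1 i2] at h1
  rw [integral_add i3 i2] at hparts
  simp only [Pi.sub_apply, mul_sub]
  rw [integral_sub i1 i3]
  linarith

/-- A weak solution agrees almost everywhere with a continuous function, which the integral equation
then makes differentiable. Its modulus is conserved, so the equation becomes linear with a constant
real frequency; no Lipschitz estimate for the nonlinearity enters. -/
theorem exists_ae_eq_flow_of_weak_solution {lam σ : ℝ} (hσ : 0 < σ) {V : ℝ → ℂ}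
    (hV : LocallyIntegrableOn V (Ioi 0))
    (hN : LocallyIntegrableOn (fun t => nonlin σ (V t)) (Ioi 0))
    (h : ∀ η : ℝ → ℝ, ContDiff ℝ ∞ η → HasCompactSupport η → tsupport η ⊆ Ioi 0 →
      ∫ t, (deriv η t • V t + η t • (-Complex.I * lam * nonlin σ (V t))) = 0) :
    ∃ A : ℂ, ∀ᵐ t, 0 < t → V t = flow lam σ t A := by
  set g : ℝ → ℂ := fun t => -Complex.I * lam * nonlin σ (V t) with hg
  have hgl : LocallyIntegrableOn g (Ioi 0) := fun t ht => by
    obtain ⟨s, hs, hfs⟩ := hN t ht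
    exact ⟨s, hs, hfs.const_mul _⟩
  have hre : ∀ {f : ℝ → ℂ}, LocallyIntegrableOn f (Ioi 0) →
      LocallyIntegrableOn (fun t => (f t).re) (Ioi 0) := fun hf t ht => by
    obtain ⟨s, hs, hfs⟩ := hf t ht
    exact ⟨s, hs, hfs.re⟩
  have him : ∀ {f : ℝ → ℂ}, LocallyIntegrableOn f (Ioi 0) →
      LocallyIntegrableOn (fun t => (f t).im) (Ioi 0) := fun hf t ht => by
    obtain ⟨s, hs, hfs⟩ := hf t ht
    exact ⟨s, hs, hfs.im⟩
  have hint : ∀ η : ℝ → ℝ, ContDiff ℝ ∞ η → HasCompactSupport η → tsupport η ⊆ Ioi 0 →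
      Integrable fun t => deriv η t • V t + η t • g t := fun η hη hηc hηs =>
    (integrable_smul_of_tsupport_subset isOpen_Ioi hV (hη.continuous_deriv (by simp)) hηc.deriv
      (subset_trans (tsupport_deriv_subset) hηs)).add
    (integrable_smul_of_tsupport_subset isOpen_Ioi hgl hη.continuous hηc hηs)
  obtain ⟨C₁, hC₁⟩ := ae_eq_primitive_of_weak_deriv (hre hV) (hre hgl) (fun η hη hηc hηs => by
    have h1 := Complex.reCLM.integral_comp_comm (hint η hη hηc hηs)
    rw [h η hη hηc hηs] at h1
    simpa using h1)
  obtain ⟨C₂, hC₂⟩ := ae_eq_primitive_of_weak_deriv (him hV) (him hgl) (fun η hη hηc hηs => by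
    have h1 := Complex.imCLM.integral_comp_comm (hint η hη hηc hηs)
    rw [h η hη hηc hηs] at h1
    simpa using h1)
  set v : ℝ → ℂ := fun t => (C₁ + C₂ * Complex.I) + ∫ s in (1 : ℝ)..t, g s with hv
  have hVv : ∀ᵐ t, 0 < t → V t = v t := by
    filter_upwards [hC₁, hC₂] with t h1 h2 ht
    have hI := intervalIntegrable_of_locallyIntegrableOn_Ioi hgl one_pos ht
    have e1 := Complex.reCLM.intervalIntegral_comp_comm hI
    have e2 := Complex.imCLM.intervalIntegral_comp_comm hI
    apply Complex.ext
    · rw [h1 ht]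
      simp only [Complex.reCLM_apply] at e1
      simp [hv, e1]
    · rw [h2 ht]
      simp only [Complex.imCLM_apply] at e2
      simp [hv, e2]
  have hvc : ContinuousOn v (Ioi 0) := continuousOn_const.add (continuousOn_primitive_Ioi hgl)
  have hgc : ContinuousOn (fun t => -Complex.I * lam * nonlin σ (v t)) (Ioi 0) :=
    continuousOn_const.mul ((continuous_nonlin hσ).comp_continuousOn hvc)
  -- Replacing `V` by its continuous representative inside the integral makes the integrand
  -- continuous, so the fundamental theorem of calculus applies at every time.
  have hv' : ∀ t, 0 < t →
      v t = (C₁ + C₂ * Complex.I) + ∫ s in (1 : ℝ)..t, -Complex.I * lam * nonlin σ (v s) := by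
    intro t ht
    simp only [hv]
    congr 1
    refine intervalIntegral.integral_congr_ae ?_
    filter_upwards [hVv] with s hs hsm
    have hs0 : 0 < s := (lt_min one_pos ht).trans hsm.1
    simp only [hg, hs hs0, hv]
  have hder : ∀ t, 0 < t → HasDerivAt v (-Complex.I * lam * nonlin σ (v t)) t := by
    intro t ht
    have hnh : Ioi (0 : ℝ) ∈ 𝓝 t := Ioi_mem_nhds ht
    have h1 : HasDerivAt (fun t => ∫ s in (1 : ℝ)..t, -Complex.I * lam * nonlin σ (v s))
        (-Complex.I * lam * nonlin σ (v t)) t := by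
      refine intervalIntegral.integral_hasDerivAt_right ?_ ?_ (hgc.continuousAt hnh)
      · exact (hgc.mono fun s hs => (lt_min one_pos ht).trans_le hs.1).intervalIntegrable
      · exact hgc.stronglyMeasurableAtFilter isOpen_Ioi t ht
    refine (h1.const_add (C₁ + C₂ * Complex.I)).congr_of_eventuallyEq ?_
    filter_upwards [hnh] with s hs using hv' s hs
  -- The derivative of `v` is a real multiple of `i v`, orthogonal to `v`.
  have hnorm : ∀ t, 0 < t → ‖v t‖ = ‖v 1‖ := by
    have hd : ∀ t ∈ Ioi (0 : ℝ), HasDerivAt (fun t => ‖v t‖ ^ 2) 0 t := by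
      intro t ht
      refine ((hder t ht).norm_sq).congr_deriv ?_
      rw [nonlin, Complex.inner]
      have : -Complex.I * lam * (((‖v t‖ ^ (2 * σ) : ℝ) : ℂ) * v t) * (starRingEnd ℂ) (v t) =
        ((-(lam * ‖v t‖ ^ (2 * σ) * Complex.normSq (v t)) : ℝ) : ℂ) * Complex.I := by
        push_cast
        rw [← Complex.mul_conj]
        ring
      rw [this]
      simp
    intro t ht
    obtain ⟨k, hk⟩ := isOpen_Ioi.exists_is_const_of_deriv_eq_zero (convex_Ioi (0 : ℝ)).isPreconnected
      (fun t ht => (hd t ht).differentiableAt.differentiableWithinAt) (fun t ht => (hd t ht).deriv)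
    have h1 : ‖v t‖ ^ 2 = ‖v 1‖ ^ 2 := (hk t ht).trans (hk 1 (mem_Ioi.2 one_pos)).symm
    exact (sq_eq_sq₀ (norm_nonneg _) (norm_nonneg _)).1 h1
  set b : ℝ := lam * ‖v 1‖ ^ (2 * σ) with hb
  have hd : ∀ t ∈ Ioi (0 : ℝ), HasDerivAt (fun t => wave b t * v t) 0 t := by
    intro t ht
    refine ((hasDerivAt_wave b t).mul (hder t ht)).congr_deriv ?_
    rw [nonlin, hnorm t ht, hb]
    push_cast
    ring
  obtain ⟨A, hA⟩ := isOpen_Ioi.exists_is_const_of_deriv_eq_zero (convex_Ioi (0 : ℝ)).isPreconnected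
      (fun t ht => (hd t ht).differentiableAt.differentiableWithinAt) (fun t ht => (hd t ht).deriv)
  have hAn : ‖A‖ = ‖v 1‖ := by
    rw [← hA 1 (mem_Ioi.2 one_pos), norm_mul, norm_wave, one_mul]
  refine ⟨A, ?_⟩
  filter_upwards [hVv] with t ht h0
  rw [ht h0, flow, hAn, ← hA t h0, ← mul_assoc]
  have : Complex.exp (Complex.I * ((-(lam * t * ‖v 1‖ ^ (2 * σ)) : ℝ) : ℂ)) = wave (-b) t := by
    rw [wave, hb]
    congr 3
    ring
  rw [this, wave_neg_mul_wave, one_mul]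


/-! ### Slicing a weak equation on space-time -/

theorem integrable_smul_slab {V : ℝ × Space d → ℂ} (hV : LocallyIntegrableOn V (spaceTime d))
    {θ : ℝ → ℝ} (hθ : Continuous θ) (hθc : HasCompactSupport θ) (hθs : tsupport θ ⊆ Ioi 0)
    {K : Set (Space d)} (hK : IsCompact K) :
    Integrable (fun p : ℝ × Space d => θ p.1 • V p)
      ((volume : Measure ℝ).prod ((volume : Measure (Space d)).restrict K)) := by
  have h1 : IntegrableOn V (tsupport θ ×ˢ K) :=
    (locallyIntegrableOn_iff (spaceTime d).isOpen.isLocallyClosed).1 hV _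
      (prod_mono hθs (subset_univ _)) (hθc.isCompact.prod hK)
  have h2 : IntegrableOn (fun p : ℝ × Space d => θ p.1 • V p) (tsupport θ ×ˢ K) :=
    h1.continuousOn_smul (hθ.comp continuous_fst).continuousOn (hθc.isCompact.prod hK)
  have h3 : IntegrableOn (fun p : ℝ × Space d => θ p.1 • V p) (univ ×ˢ K) := by
    refine h2.of_forall_sdiff_eq_zero (MeasurableSet.univ.prod hK.measurableSet) fun p hp => ?_
    rw [image_eq_zero_of_notMem_tsupport (fun h => hp.2 ⟨h, hp.1.2⟩), zero_smul]
  rw [IntegrableOn, Measure.volume_eq_prod, ← Measure.prod_restrict, Measure.restrict_univ] at h3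
  exact h3

theorem ae_locallyIntegrableOn_slice {V : ℝ × Space d → ℂ}
    (hV : LocallyIntegrableOn V (spaceTime d)) :
    ∀ᵐ y : Space d, LocallyIntegrableOn (fun t => V (t, y)) (Ioi 0) := by
  have h : ∀ n : ℕ, ∀ᵐ y : Space d, y ∈ Metric.closedBall (0 : Space d) n →
      IntegrableOn (fun t => V (t, y)) (Icc (1 / ((n : ℝ) + 1)) n) := by
    intro n
    have h1 : IntegrableOn V (Icc (1 / ((n : ℝ) + 1)) n ×ˢ Metric.closedBall (0 : Space d) n) :=
      (locallyIntegrableOn_iff (spaceTime d).isOpen.isLocallyClosed).1 hV _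
        (prod_mono (fun t ht => lt_of_lt_of_le (by positivity) ht.1) (subset_univ _))
        (isCompact_Icc.prod (isCompact_closedBall _ _))
    rw [IntegrableOn, Measure.volume_eq_prod, ← Measure.prod_restrict] at h1
    exact (ae_restrict_iff' Metric.isClosed_closedBall.measurableSet).1 h1.prod_left_ae
  filter_upwards [ae_all_iff.2 h] with y hy
  rw [locallyIntegrableOn_iff isOpen_Ioi.isLocallyClosed]
  intro K hK hKc
  obtain ⟨p, q, hp, -, -, hpq⟩ := exists_Ioo_superset hKc hK
  obtain ⟨n, hn⟩ := exists_nat_ge (max (max (1 / p) q) ‖y‖)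
  have h1 : 1 / p ≤ n := (le_max_left _ _).trans ((le_max_left _ _).trans hn)
  have h2 : q ≤ n := (le_max_right _ _).trans ((le_max_left _ _).trans hn)
  have h3 : ‖y‖ ≤ n := (le_max_right _ _).trans hn
  refine (hy n (by simpa using h3)).mono_set fun t ht => ?_
  have h4 := hpq ht
  refine ⟨le_trans ?_ h4.1.le, h4.2.le.trans h2⟩
  rw [div_le_iff₀ (by positivity)]
  rw [div_le_iff₀ hp] at h1
  nlinarith

/-- Test functions on a compact set are separable for the `C¹` topology. -/
theorem exists_countable_dense_test (K : Set ℝ) (hK : IsCompact K) :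
    ∃ S : Set (ℝ → ℝ), S.Countable ∧
      (∀ η ∈ S, ContDiff ℝ ∞ η ∧ tsupport η ⊆ K) ∧
      ∀ η : ℝ → ℝ, ContDiff ℝ ∞ η → tsupport η ⊆ K → ∀ ε > 0, ∃ ψ ∈ S, ∀ t,
        |η t - ψ t| ≤ ε ∧ |deriv η t - deriv ψ t| ≤ ε := by
  have : CompactSpace K := isCompact_iff_compactSpace.1 hK
  let X : Type := {η : ℝ → ℝ // ContDiff ℝ ∞ η ∧ tsupport η ⊆ K}
  -- The `C¹` topology is the one induced from this separable metric space, and every subset of a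
  -- separable metric space is separable.
  let ι : X → C(K, ℝ) × C(K, ℝ) := fun η =>
    (⟨fun t => η.1 t, η.2.1.continuous.comp continuous_subtype_val⟩,
      ⟨fun t => deriv η.1 t, (η.2.1.continuous_deriv (by simp)).comp continuous_subtype_val⟩)
  obtain ⟨T, hT, hTc, hTd⟩ :=
    (TopologicalSpace.IsSeparable.of_separableSpace (range ι)).exists_countable_dense_subset
  choose g hg using fun p : T => hT p.2
  have := hTc.to_subtype
  refine ⟨range fun p : T => (g p).1, countable_range _, ?_, fun η hη hηK ε hε => ?_⟩
  · rintro _ ⟨p, rfl⟩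
    exact (g p).2
  obtain ⟨b, hb, hbd⟩ := Metric.mem_closure_iff.1 (hTd ⟨⟨η, hη, hηK⟩, rfl⟩) ε hε
  refine ⟨(g ⟨b, hb⟩).1, ⟨⟨b, hb⟩, rfl⟩, fun t => ?_⟩
  rw [← show ι (g ⟨b, hb⟩) = b from hg ⟨b, hb⟩, Prod.dist_eq, max_lt_iff] at hbd
  by_cases ht : t ∈ K
  · have h1 := (ContinuousMap.dist_apply_le_dist (⟨t, ht⟩ : K)).trans hbd.1.le
    have h2 := (ContinuousMap.dist_apply_le_dist (⟨t, ht⟩ : K)).trans hbd.2.le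
    exact ⟨h1, h2⟩
  · have hz : ∀ ψ : ℝ → ℝ, tsupport ψ ⊆ K → ψ t = 0 ∧ deriv ψ t = 0 := fun ψ hψ =>
      ⟨image_eq_zero_of_notMem_tsupport fun h => ht (hψ h),
        image_eq_zero_of_notMem_tsupport fun h => ht (hψ (tsupport_deriv_subset h))⟩
    obtain ⟨h1, h2⟩ := hz η hηK
    obtain ⟨h3, h4⟩ := hz _ (g ⟨b, hb⟩).2.2
    rw [h1, h2, h3, h4]
    simp [hε.le]

/-- By Fubini the time integral is a locally integrable function of `y` that annihilates every test
function `χ`. The exceptional null set still depends on `η`. -/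
theorem ae_slice_weak_of_test {V G : ℝ × Space d → ℂ} (hV : LocallyIntegrableOn V (spaceTime d))
    (hG : LocallyIntegrableOn G (spaceTime d)) {η : ℝ → ℝ} (hη : ContDiff ℝ ∞ η)
    (hηc : HasCompactSupport η) (hηs : tsupport η ⊆ Ioi 0)
    (h : ∀ χ : Space d → ℝ, ContDiff ℝ ∞ χ → HasCompactSupport χ →
      ∫ p in (spaceTime d : Set (ℝ × Space d)),
        χ p.2 • (deriv η p.1 • V p + η p.1 • G p) = 0) :
    ∀ᵐ y : Space d, ∫ t, (deriv η t • V (t, y) + η t • G (t, y)) = 0 := by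
  set H : ℝ × Space d → ℂ := fun p => deriv η p.1 • V p + η p.1 • G p with hH
  have hint : ∀ K : Set (Space d), IsCompact K →
      Integrable H ((volume : Measure ℝ).prod ((volume : Measure (Space d)).restrict K)) :=
    fun K hK => (integrable_smul_slab hV (hη.continuous_deriv (by simp)) hηc.deriv
      (subset_trans tsupport_deriv_subset hηs) hK).add
      (integrable_smul_slab hG hη.continuous hηc hηs hK)
  have hloc : LocallyIntegrable fun y : Space d => ∫ t, H (t, y) :=
    locallyIntegrable_iff.2 fun K hK => (hint K hK).integral_prod_right
  refine ae_eq_zero_of_integral_contDiff_smul_eq_zero hloc fun χ hχ hχc => ?_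
  have hout : ∀ p ∉ (spaceTime d : Set (ℝ × Space d)), χ p.2 • H p = 0 := by
    rintro ⟨t, y⟩ hp
    have ht : t ∉ tsupport η := fun h' => hp ⟨hηs h', trivial⟩
    have ht' : t ∉ tsupport (deriv η) := fun h' => ht (tsupport_deriv_subset h')
    simp [hH, image_eq_zero_of_notMem_tsupport ht, image_eq_zero_of_notMem_tsupport ht']
  have h1 := h χ hχ hχc
  rw [setIntegral_eq_integral_of_forall_compl_eq_zero hout] at h1
  have hint' : Integrable (fun p : ℝ × Space d => χ p.2 • H p) := by
    have h2 := hint _ hχc.isCompact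
    rw [← Measure.restrict_univ (μ := (volume : Measure ℝ)), Measure.prod_restrict,
      ← Measure.volume_eq_prod] at h2
    obtain ⟨C, hC⟩ := hχ.continuous.bounded_above_of_compact_support hχc
    have h3 : IntegrableOn (fun p : ℝ × Space d => χ p.2 • H p) (univ ×ˢ tsupport χ) :=
      Integrable.bdd_smul h2 C (hχ.continuous.comp continuous_snd).aestronglyMeasurable
        (.of_forall fun p => hC p.2)
    rw [← integrableOn_univ]
    refine h3.of_forall_sdiff_eq_zero MeasurableSet.univ fun p hp => ?_
    rw [image_eq_zero_of_notMem_tsupport (fun h => hp.2 ⟨trivial, h⟩), zero_smul]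
  rw [Measure.volume_eq_prod] at hint' h1
  rw [integral_prod_symm _ hint'] at h1
  rw [← h1]
  exact integral_congr_ae (.of_forall fun y => (integral_smul _ _).symm)

/-- A single null set serves all `η`: the identity is imposed on countably many tests, `C¹`-dense on
each compact set of an exhaustion of `(0, ∞)`. It extends to the others since `V (·, y)` and `G (·,
y)` are integrable on these compact sets. -/
theorem ae_slice_weak {V G : ℝ × Space d → ℂ} (hV : LocallyIntegrableOn V (spaceTime d))
    (hG : LocallyIntegrableOn G (spaceTime d))
    (h : ∀ η : ℝ → ℝ, ContDiff ℝ ∞ η → HasCompactSupport η → tsupport η ⊆ Ioi 0 →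
      ∀ χ : Space d → ℝ, ContDiff ℝ ∞ χ → HasCompactSupport χ →
      ∫ p in (spaceTime d : Set (ℝ × Space d)),
        χ p.2 • (deriv η p.1 • V p + η p.1 • G p) = 0) :
    ∀ᵐ y : Space d, ∀ η : ℝ → ℝ, ContDiff ℝ ∞ η → HasCompactSupport η → tsupport η ⊆ Ioi 0 →
      ∫ t, (deriv η t • V (t, y) + η t • G (t, y)) = 0 := by
  set K : ℕ → Set ℝ := fun n => Icc (1 / ((n : ℝ) + 1)) n with hKdef
  have hKc : ∀ n, IsCompact (K n) := fun n => isCompact_Icc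
  have hK0 : ∀ n, K n ⊆ Ioi 0 := fun n t ht => lt_of_lt_of_le (by positivity) ht.1
  choose S hSc hS hSd using fun n => exists_countable_dense_test (K n) (hKc n)
  have hcs : ∀ {n : ℕ} {η : ℝ → ℝ}, tsupport η ⊆ K n → HasCompactSupport η := fun h =>
    (hKc _).of_isClosed_subset (isClosed_tsupport _) h
  have hall : ∀ᵐ y : Space d, ∀ n, ∀ η ∈ S n,
      ∫ t, (deriv η t • V (t, y) + η t • G (t, y)) = 0 := by
    refine ae_all_iff.2 fun n => (ae_ball_iff (hSc n)).2 fun η hη => ?_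
    have h1 := hcs (hS n η hη).2
    have h2 := (hS n η hη).2.trans (hK0 n)
    exact ae_slice_weak_of_test hV hG (hS n η hη).1 h1 h2 (h η (hS n η hη).1 h1 h2)
  filter_upwards [hall, ae_locallyIntegrableOn_slice hV, ae_locallyIntegrableOn_slice hG]
    with y hy hVy hGy η hη hηc hηs
  obtain ⟨p, q, hp, -, -, hpq⟩ := exists_Ioo_superset hηc hηs
  obtain ⟨n, hn⟩ := exists_nat_ge (max (1 / p) q)
  have hηK : tsupport η ⊆ K n := by
    intro t ht
    have h4 := hpq ht
    have h1 : 1 / p ≤ n := (le_max_left _ _).trans hn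
    refine ⟨le_trans ?_ h4.1.le, h4.2.le.trans ((le_max_right _ _).trans hn)⟩
    rw [div_le_iff₀ (by positivity)]
    rw [div_le_iff₀ hp] at h1
    nlinarith
  have hI : ∀ {ψ : ℝ → ℝ}, ContDiff ℝ ∞ ψ → tsupport ψ ⊆ K n →
      Integrable fun t => deriv ψ t • V (t, y) + ψ t • G (t, y) := fun hψ hψK =>
    (integrable_smul_of_tsupport_subset isOpen_Ioi hVy (hψ.continuous_deriv (by simp))
      (hcs hψK).deriv (subset_trans tsupport_deriv_subset (hψK.trans (hK0 n)))).add
    (integrable_smul_of_tsupport_subset isOpen_Ioi hGy hψ.continuous (hcs hψK)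
      (hψK.trans (hK0 n)))
  have hVK : IntegrableOn (fun t => V (t, y)) (K n) :=
    (locallyIntegrableOn_iff isOpen_Ioi.isLocallyClosed).1 hVy _ (hK0 n) (hKc n)
  have hGK : IntegrableOn (fun t => G (t, y)) (K n) :=
    (locallyIntegrableOn_iff isOpen_Ioi.isLocallyClosed).1 hGy _ (hK0 n) (hKc n)
  set B : ℝ := ∫ t in K n, (‖V (t, y)‖ + ‖G (t, y)‖) with hB
  have hB0 : 0 ≤ B := integral_nonneg fun t => by positivity
  have hbound : ∀ ε > 0, ‖∫ t, (deriv η t • V (t, y) + η t • G (t, y))‖ ≤ ε * B := by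
    intro ε hε
    obtain ⟨ψ, hψS, hψ⟩ := hSd n η hη hηK ε hε
    obtain ⟨hψd, hψK⟩ := hS n ψ hψS
    rw [← sub_zero (∫ t, (deriv η t • V (t, y) + η t • G (t, y))), ← hy n ψ hψS,
      ← integral_sub (hI hη hηK) (hI hψd hψK), hB, ← integral_const_mul,
      ← setIntegral_eq_integral_of_forall_compl_eq_zero (s := K n)]
    · refine norm_integral_le_of_norm_le ((hVK.norm.add hGK.norm).const_mul ε) (.of_forall fun t => ?_)
      have e : deriv η t • V (t, y) + η t • G (t, y) - (deriv ψ t • V (t, y) + ψ t • G (t, y)) =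
          (deriv η t - deriv ψ t) • V (t, y) + (η t - ψ t) • G (t, y) := by
        rw [sub_smul, sub_smul]; abel
      rw [e, mul_add]
      refine (norm_add_le _ _).trans ?_
      rw [norm_smul, norm_smul, Real.norm_eq_abs, Real.norm_eq_abs]
      gcongr
      · exact (hψ t).2
      · exact (hψ t).1
    · intro t ht
      have hz : ∀ φ : ℝ → ℝ, tsupport φ ⊆ K n → φ t = 0 ∧ deriv φ t = 0 := fun φ hφ =>
        ⟨image_eq_zero_of_notMem_tsupport fun h => ht (hφ h),
          image_eq_zero_of_notMem_tsupport fun h => ht (hφ (tsupport_deriv_subset h))⟩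
      rw [(hz η hηK).1, (hz η hηK).2, (hz ψ hψK).1, (hz ψ hψK).2]
      simp
  have hlim : Tendsto (fun ε : ℝ => ε * B) (𝓝[>] 0) (𝓝 0) := by
    have : Tendsto (fun ε : ℝ => ε * B) (𝓝 0) (𝓝 (0 * B)) :=
      tendsto_id.mul_const B
    rw [zero_mul] at this
    exact this.mono_left nhdsWithin_le_nhds
  refine norm_le_zero_iff.1 (ge_of_tendsto hlim ?_)
  filter_upwards [self_mem_nhdsWithin] with ε hε using hbound ε hε


/-! ### Uniqueness -/

theorem flow_neg_flow (lam σ t : ℝ) (z : ℂ) : flow lam σ (-t) (flow lam σ t z) = z := by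
  rw [flow, norm_flow, flow, ← mul_assoc, ← Complex.exp_add]
  have : Complex.I * ((-(lam * -t * ‖z‖ ^ (2 * σ)) : ℝ) : ℂ) +
      Complex.I * ((-(lam * t * ‖z‖ ^ (2 * σ)) : ℝ) : ℂ) = 0 := by
    push_cast
    ring
  rw [this, Complex.exp_zero, one_mul]

theorem locallyIntegrableOn_wave_mul (b : ℝ) {g : ℝ × Space d → ℂ}
    (hg : LocallyIntegrableOn g (spaceTime d)) :
    LocallyIntegrableOn (fun p => wave b p.1 * g p) (spaceTime d) := by
  rw [locallyIntegrableOn_iff (spaceTime d).isOpen.isLocallyClosed] at hg ⊢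
  intro K hK hKc
  exact (hg K hK hKc).continuousOn_mul ((continuous_wave b).comp continuous_fst).continuousOn hKc

/-- Conjugation by the transport group turns a weak solution into a weak solution of an ordinary
differential equation with parameter. -/
theorem straightened_equation {P : Space d → ℝ} {c : Space d} {a : ℝ}
    (hP : ∀ ξ, P ξ = inner ℝ c ξ + a) {lam σ : ℝ} {U : ℝ × Space d → ℂ}
    (hU : ∀ Φ : 𝓓(spaceTime d, ℂ),
      ∫ p in (spaceTime d : Set (ℝ × Space d)),
        (-(Complex.I * U p * deriv (fun s => Φ (s, p.2)) p.1)
          + U p * multTranspose P (fun x => Φ (p.1, x)) p.2) =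
      ∫ p in (spaceTime d : Set (ℝ × Space d)), (lam : ℂ) * nonlin σ (U p) * Φ p)
    {V : ℝ × Space d → ℂ} (hV : ∀ p, V p = wave (-a) p.1 * U ((shear c).symm p))
    (hVl : LocallyIntegrableOn V (spaceTime d))
    (hVn : LocallyIntegrableOn (fun p => nonlin σ (V p)) (spaceTime d))
    {η : ℝ → ℝ} (hη : ContDiff ℝ ∞ η) (hηc : HasCompactSupport η) (hηs : tsupport η ⊆ Ioi 0)
    {χ : Space d → ℝ} (hχ : ContDiff ℝ ∞ χ) (hχc : HasCompactSupport χ) :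
    ∫ p in (spaceTime d : Set (ℝ × Space d)),
      χ p.2 • (deriv η p.1 • V p + η p.1 • (-Complex.I * lam * nonlin σ (V p))) = 0 := by
  set Θ : ℝ × Space d → ℂ := fun p => ((η p.1 * χ p.2 : ℝ) : ℂ) with hΘ
  have hΘd : ContDiff ℝ ∞ Θ := Complex.ofRealCLM.contDiff.comp
    ((hη.comp contDiff_fst).mul (hχ.comp contDiff_snd))
  have hΘs : ∀ p ∉ tsupport η ×ˢ tsupport χ, Θ p = 0 := by
    intro p hp
    by_cases h : p.1 ∈ tsupport η
    · have : χ p.2 = 0 := image_eq_zero_of_notMem_tsupport fun h' => hp ⟨h, h'⟩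
      simp [hΘ, this]
    · simp [hΘ, image_eq_zero_of_notMem_tsupport h]
  have hΘc : HasCompactSupport Θ := HasCompactSupport.intro (hηc.isCompact.prod hχc.isCompact) hΘs
  have hΘt : tsupport Θ ⊆ spaceTime d :=
    (closure_minimal (fun p (hp : Θ p ≠ 0) => by_contra fun h => hp (hΘs p h))
      ((isClosed_tsupport η).prod (isClosed_tsupport χ))).trans (prod_mono hηs (subset_univ _))
  -- The product `η(t) χ(y)` is carried back to the original coordinates by the inverse of the
  -- straightening, hence the parameters `-c` and `-a`.
  set Ψ : ℝ × Space d → ℂ := fun p => wave (-a) p.1 * Θ (p.1, p.2 - p.1 • -c) with hΨ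
  have hΨs : tsupport Ψ ⊆ spaceTime d := by
    have h1 : tsupport Ψ ⊆ shear c ⁻¹' tsupport Θ := by
      refine closure_minimal (fun q hq => ?_)
        ((isClosed_tsupport _).preimage (shear c).continuous)
      have h2 := subset_tsupport _ (right_ne_zero_of_mul hq)
      simpa [shear] using h2
    refine h1.trans ((preimage_mono hΘt).trans ?_)
    rw [shear_preimage_spaceTime]
  let Φ : 𝓓(spaceTime d, ℂ) := ⟨Ψ, contDiff_straighten (-c) (-a) hΘd,
    hasCompactSupport_straighten (-c) (-a) hΘc, hΨs⟩
  have hΦ : ∀ t x, Φ (t, x) = wave (-a) t * Θ (t, x + t • c) := fun t x => by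
    change wave (-a) t * Θ (t, x - t • -c) = _
    rw [smul_neg, sub_neg_eq_add]
  have hVs : ∀ t x, V (t, x + t • c) = wave (-a) t * U (t, x) := fun t x => by
    rw [hV, shear_symm_apply, add_sub_cancel_right]
  have hw : ∀ t, wave a t * wave (-a) t = 1 := fun t => by rw [mul_comm, wave_neg_mul_wave]
  set g : ℝ × Space d → ℂ := fun p => -Complex.I * V p * ((deriv η p.1 * χ p.2 : ℝ) : ℂ) with hg
  set k : ℝ × Space d → ℂ := fun p => lam * nonlin σ (V p) * ((η p.1 * χ p.2 : ℝ) : ℂ) with hk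
  have hleft : ∀ p : ℝ × Space d,
      -(Complex.I * U p * deriv (fun s => Φ (s, p.2)) p.1)
          + U p * multTranspose P (fun x => Φ (p.1, x)) p.2 = g (shear c p) := by
    rintro ⟨t, x⟩
    rw [transport_eq_deriv hP Φ.contDiff Φ.hasCompactSupport, shear_apply]
    have h1 : (fun s => wave a s * Φ (s, x + t • c - s • c)) =
        fun s => ((η s * χ (x + t • c) : ℝ) : ℂ) := by
      funext s
      rw [hΦ, sub_add_cancel, ← mul_assoc, hw, one_mul]
    have h2 : HasDerivAt (fun s => ((η s * χ (x + t • c) : ℝ) : ℂ))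
        ((deriv η t * χ (x + t • c) : ℝ) : ℂ) t :=
      (((hη.differentiable (by simp) t).hasDerivAt).mul_const _).ofReal_comp
    rw [h1, h2.deriv, hg]
    simp only
    rw [hVs]
  have hright : ∀ p : ℝ × Space d, (lam : ℂ) * nonlin σ (U p) * Φ p = k (shear c p) := by
    rintro ⟨t, x⟩
    rw [hΦ, shear_apply, hk]
    simp only
    rw [hVs, nonlin_mul_of_norm_one σ (norm_wave _ _)]
    ring
  have h := hU Φ
  simp_rw [hleft, hright] at h
  rw [setIntegral_comp_shear, setIntegral_comp_shear] at h
  have hint : ∀ {W : ℝ × Space d → ℂ} {θ : ℝ → ℝ}, LocallyIntegrableOn W (spaceTime d) →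
      Continuous θ → HasCompactSupport θ → tsupport θ ⊆ Ioi 0 →
      IntegrableOn (fun p => W p * ((θ p.1 * χ p.2 : ℝ) : ℂ)) (spaceTime d) := by
    intro W θ hW hθ hθc hθs
    have hK : IsCompact (tsupport θ ×ˢ tsupport χ) := hθc.isCompact.prod hχc.isCompact
    have h1 : IntegrableOn W (tsupport θ ×ˢ tsupport χ) :=
      (locallyIntegrableOn_iff (spaceTime d).isOpen.isLocallyClosed).1 hW _
        (prod_mono hθs (subset_univ _)) hK
    have hcont : Continuous fun p : ℝ × Space d => ((θ p.1 * χ p.2 : ℝ) : ℂ) := by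
      have := hχ.continuous
      fun_prop
    refine (h1.mul_continuousOn hcont.continuousOn hK).of_forall_sdiff_eq_zero
      (spaceTime d).isOpen.measurableSet fun p hp => ?_
    have : θ p.1 * χ p.2 = 0 := by
      by_cases h : p.1 ∈ tsupport θ
      · rw [image_eq_zero_of_notMem_tsupport (f := χ) fun h' => hp.2 ⟨h, h'⟩, mul_zero]
      · rw [image_eq_zero_of_notMem_tsupport h, zero_mul]
    rw [this, Complex.ofReal_zero, mul_zero]
  have hgi : IntegrableOn g (spaceTime d) := by
    refine ((hint hVl (hη.continuous_deriv (by simp)) hηc.deriv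
      (subset_trans tsupport_deriv_subset hηs)).const_mul (-Complex.I)).congr
      (.of_forall fun p => ?_)
    simp only [hg]
    ring
  have hki : IntegrableOn k (spaceTime d) := by
    refine ((hint hVn hη.continuous hηc hηs).const_mul (lam : ℂ)).congr (.of_forall fun p => ?_)
    simp only [hk]
    ring
  have hsum : ∀ p : ℝ × Space d,
      χ p.2 • (deriv η p.1 • V p + η p.1 • (-Complex.I * lam * nonlin σ (V p))) =
        Complex.I * (g p - k p) := by
    intro p
    simp only [hg, hk, Complex.real_smul]
    push_cast
    linear_combination ((deriv η p.1 : ℝ) * V p * χ p.2) * Complex.I_sq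
  simp_rw [hsum]
  rw [integral_const_mul, integral_sub hgi hki, h, sub_self, mul_zero]

theorem aestronglyMeasurable_flow {X : Type*} [MeasurableSpace X] {μ : Measure X} {lam σ : ℝ}
    (hσ : 0 < σ) {t : X → ℝ} {z : X → ℂ} (ht : AEStronglyMeasurable t μ)
    (hz : AEStronglyMeasurable z μ) : AEStronglyMeasurable (fun x => flow lam σ (t x) (z x)) μ := by
  have h : Continuous fun q : ℝ × ℂ => flow lam σ q.1 q.2 :=
    continuous_flow hσ continuous_fst continuous_snd
  have hp : AEStronglyMeasurable (fun x => (t x, z x)) μ := ht.prodMk hz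
  exact Continuous.comp_aestronglyMeasurable (g := fun q : ℝ × ℂ => flow lam σ q.1 q.2)
    (f := fun x => (t x, z x)) h hp

theorem aestronglyMeasurable_average_flow {lam σ : ℝ} (hσ : 0 < σ) {V : ℝ × Space d → ℂ}
    {μ : Measure ℝ} [SFinite μ] (hV : AEStronglyMeasurable V (μ.prod (volume : Measure (Space d)))) :
    AEStronglyMeasurable (fun y => ∫ t, flow lam σ (-t) (V (t, y)) ∂μ)
      (volume : Measure (Space d)) := by
  have h1 : AEStronglyMeasurable (fun p : ℝ × Space d => flow lam σ (-p.1) (V p))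
      (μ.prod (volume : Measure (Space d))) :=
    aestronglyMeasurable_flow hσ continuous_fst.neg.aestronglyMeasurable hV
  exact AEStronglyMeasurable.integral_prod_right' (E := ℂ)
    (f := fun q : Space d × ℝ => flow lam σ (-q.2) (V (q.2, q.1))) h1.prod_swap

/-- The set where the equality holds need not be measurable, so the exchange of quantifiers is made
for measurable representatives of `V` and `A`. -/
theorem ae_ae_eq_comm {f : ℝ × ℂ → ℂ} (hf : Continuous f) {V : ℝ × Space d → ℂ} {A : Space d → ℂ}
    {μ : Measure ℝ} [SFinite μ] (hV : AEStronglyMeasurable V (μ.prod (volume : Measure (Space d))))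
    (hA : AEStronglyMeasurable A)
    (h : ∀ᵐ y : Space d, ∀ᵐ t ∂μ, V (t, y) = f (t, A y)) :
    ∀ᵐ t ∂μ, ∀ᵐ y : Space d, V (t, y) = f (t, A y) := by
  obtain ⟨V', hV'm, hVV'⟩ := hV
  obtain ⟨A', hA'm, hAA'⟩ := hA
  have hm : Measurable fun p : ℝ × Space d => (p.1, A' p.2) :=
    measurable_fst.prodMk (hA'm.measurable.comp measurable_snd)
  have hfm : Measurable fun p : ℝ × Space d => f (p.1, A' p.2) :=
    hf.measurable.comp hm
  have hmeas : MeasurableSet {p : ℝ × Space d | V' (p.1, p.2) = f (p.1, A' p.2)} :=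
    measurableSet_eq_fun hV'm.measurable hfm
  have h1 : ∀ᵐ y : Space d, ∀ᵐ t ∂μ, V (t, y) = V' (t, y) :=
    Measure.ae_ae_of_ae_prod
      (Measure.measurePreserving_swap.quasiMeasurePreserving.ae hVV')
  have h2 : ∀ᵐ y : Space d, ∀ᵐ t ∂μ, V' (t, y) = f (t, A' y) := by
    filter_upwards [h, h1, hAA'] with y hy1 hy2 hy3
    filter_upwards [hy1, hy2] with t ht1 ht2
    rw [← ht2, ht1, hy3]
  have h3 := (Measure.ae_ae_comm (μ := μ) (ν := (volume : Measure (Space d)))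
    (p := fun t y => V' (t, y) = f (t, A' y)) hmeas).2 h2
  filter_upwards [h3, Measure.ae_ae_of_ae_prod hVV'] with t ht1 ht2
  filter_upwards [ht1, ht2, hAA'] with y hy1 hy2 hy3
  rw [hy2, hy1, hy3]

/-- A pointwise choice of `A` could fail to be measurable. Averaging `flow lam σ (-t) (V (t, y))`
over `1 < t ≤ 2`, an interval of length one, recovers the same value measurably. -/
theorem exists_profile {lam σ : ℝ} (hσ : 0 < σ) {V : ℝ × Space d → ℂ}
    (hV : LocallyIntegrableOn V (spaceTime d))
    (h : ∀ᵐ y : Space d, ∃ A : ℂ, ∀ᵐ t, 0 < t → V (t, y) = flow lam σ t A) :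
    ∃ A : Space d → ℂ, AEStronglyMeasurable A ∧
      ∀ᵐ t, 0 < t → ∀ᵐ y : Space d, V (t, y) = flow lam σ t (A y) := by
  have hVm : AEStronglyMeasurable V
      (((volume : Measure ℝ).restrict (Ioi 0)).prod (volume : Measure (Space d))) := by
    have h1 := hV.aestronglyMeasurable
    have h2 : (spaceTime d : Set (ℝ × Space d)) = Ioi 0 ×ˢ univ := rfl
    rwa [h2, Measure.volume_eq_prod, ← Measure.prod_restrict, Measure.restrict_univ] at h1
  have hle : (volume : Measure ℝ).restrict (Ioc 1 2) ≤ (volume : Measure ℝ).restrict (Ioi 0) :=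
    Measure.restrict_mono_set _ fun t ht => zero_lt_one.trans ht.1
  have hAm := aestronglyMeasurable_average_flow (lam := lam) hσ
    (hVm.mono_measure (Measure.prod_mono hle le_rfl))
  have hAB : ∀ y B, (∀ᵐ t, 0 < t → V (t, y) = flow lam σ t B) →
      ∫ t in Ioc (1 : ℝ) 2, flow lam σ (-t) (V (t, y)) = B := by
    intro y B hB
    have : ∀ᵐ t ∂(volume : Measure ℝ).restrict (Ioc 1 2), flow lam σ (-t) (V (t, y)) = B := by
      rw [ae_restrict_iff' measurableSet_Ioc]
      filter_upwards [hB] with t ht htm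
      rw [ht (zero_lt_one.trans htm.1), flow_neg_flow]
    rw [integral_congr_ae this]
    norm_num
  refine ⟨_, hAm, ?_⟩
  have hfl : Continuous fun q : ℝ × ℂ => flow lam σ q.1 q.2 :=
    continuous_flow hσ continuous_fst continuous_snd
  have h1 := ae_ae_eq_comm hfl hVm hAm (by
    filter_upwards [h] with y ⟨B, hB⟩
    rw [hAB y B hB]
    exact (ae_restrict_iff' measurableSet_Ioi).2 hB)
  exact (ae_restrict_iff' measurableSet_Ioi).1 h1

/-- The translation is moved onto `φ`, since translates of a merely locally integrable `A` need not
converge pointwise. Conservation of modulus by the flow provides the dominating function. -/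
theorem tendsto_integral_flow {lam σ : ℝ} (hσ : 0 < σ) (c : Space d) (a : ℝ) {A : Space d → ℂ}
    (hA : LocallyIntegrable A) (φ : 𝓓((⊤ : Opens (Space d)), ℝ)) :
    Tendsto (fun t : ℝ => ∫ x, ((φ x : ℝ) : ℂ) * (wave a t * flow lam σ t (A (x + t • c))))
      (𝓝[>] 0) (𝓝 (∫ x, ((φ x : ℝ) : ℂ) * A x)) := by
  have hshift : ∀ t : ℝ, ∫ x, ((φ x : ℝ) : ℂ) * (wave a t * flow lam σ t (A (x + t • c))) =
      ∫ y, ((φ (y - t • c) : ℝ) : ℂ) * (wave a t * flow lam σ t (A y)) := by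
    intro t
    rw [← integral_add_right_eq_self
      (fun y => ((φ (y - t • c) : ℝ) : ℂ) * (wave a t * flow lam σ t (A y))) (t • c)]
    simp
  simp_rw [hshift]
  obtain ⟨C, hC⟩ := φ.continuous.bounded_above_of_compact_support φ.hasCompactSupport
  set K : Set (Space d) := (fun p : ℝ × Space d => p.2 + p.1 • c) '' (Icc 0 1 ×ˢ tsupport φ) with hK
  have hKc : IsCompact K :=
    (isCompact_Icc.prod φ.hasCompactSupport.isCompact).image (by fun_prop)
  have hAm : AEStronglyMeasurable A := hA.aestronglyMeasurable
  have hflt : ∀ z : ℂ, Continuous fun t => flow lam σ t z := fun z =>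
    continuous_flow hσ continuous_id continuous_const
  have hflz : ∀ t : ℝ, Continuous fun z => flow lam σ t z := fun t =>
    continuous_flow hσ continuous_const continuous_id
  refine tendsto_integral_filter_of_dominated_convergence
    (K.indicator fun y => C * ‖A y‖) (.of_forall fun t => ?_) ?_ ?_ (.of_forall fun y => ?_)
  · have h1 : Continuous fun y : Space d => ((φ (y - t • c) : ℝ) : ℂ) := by
      have := φ.continuous
      fun_prop
    exact h1.aestronglyMeasurable.mul
      (((hflz t).comp_aestronglyMeasurable hAm).const_mul _)
  · have hmem : Ioc (0 : ℝ) 1 ∈ 𝓝[>] (0 : ℝ) := Ioc_mem_nhdsGT one_pos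
    filter_upwards [hmem] with t ht
    refine .of_forall fun y => ?_
    rw [norm_mul, norm_mul, norm_wave, norm_flow, one_mul, Complex.norm_real]
    by_cases hy : y ∈ K
    · rw [indicator_of_mem hy]
      gcongr
      exact hC _
    · have : φ (y - t • c) = 0 := by
        refine image_eq_zero_of_notMem_tsupport fun h => hy ?_
        exact ⟨(t, y - t • c), ⟨⟨ht.1.le, ht.2⟩, h⟩, by simp⟩
      rw [indicator_of_notMem hy, this, norm_zero, zero_mul]
  · exact IntegrableOn.integrable_indicator
      ((hA.integrableOn_isCompact hKc).norm.const_mul C) hKc.measurableSet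
  · have hcont : Continuous fun t : ℝ =>
        ((φ (y - t • c) : ℝ) : ℂ) * (wave a t * flow lam σ t (A y)) := by
      have h1 := φ.continuous
      have h2 := continuous_wave a
      have h3 := hflt (A y)
      fun_prop
    have h0 := hcont.tendsto 0
    simp only [zero_smul, sub_zero, flow_zero] at h0
    have hw : wave a 0 = 1 := by simp [wave]
    rw [hw, one_mul] at h0
    exact h0.mono_left nhdsWithin_le_nhds

theorem continuous_apply_toNNReal (w : C(ℝ≥0, Distr d)) (φ : 𝓓((⊤ : Opens (Space d)), ℝ)) :
    Continuous fun t : ℝ => w t.toNNReal φ :=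
  (continuous_eval_const φ).comp (w.continuous.comp continuous_real_toNNReal)

/-- The solution given by a continuous initial datum, as a curve of distributions. -/
def evolutionCurve (c : Space d) (a lam : ℝ) {σ : ℝ} (hσ : 0 < σ) {v : Space d → ℝ}
    (hv : Continuous v) : C(ℝ≥0, Distr d) :=
  toDistrCurve (fun p => evolution c a lam σ v (p.1, p.2))
    ((continuous_evolution c a lam hσ hv).comp (by fun_prop))

theorem evolutionCurve_apply (c : Space d) (a lam : ℝ) {σ : ℝ} (hσ : 0 < σ) {v : Space d → ℝ}
    (hv : Continuous v) (t : ℝ≥0) (φ : 𝓓((⊤ : Opens (Space d)), ℝ)) :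
    evolutionCurve c a lam hσ hv t φ =
      ∫ x, ((φ x : ℝ) : ℂ) * (wave a t * flow lam σ t (v (x + (t : ℝ) • c))) := rfl

theorem evolutionCurve_zero_apply (c : Space d) (a lam : ℝ) {σ : ℝ} (hσ : 0 < σ)
    {v : Space d → ℝ} (hv : Continuous v) (φ : 𝓓((⊤ : Opens (Space d)), ℝ)) :
    evolutionCurve c a lam hσ hv 0 φ = ∫ x, ((φ x : ℝ) : ℂ) * (v x : ℂ) := by
  rw [evolutionCurve_apply]
  simp [flow_zero, wave]

theorem isSolution_evolutionCurve {P : Space d → ℝ} {c : Space d} {a : ℝ}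
    (hP : ∀ ξ, P ξ = inner ℝ c ξ + a) (lam : ℝ) {σ : ℝ} (hσ : 0 < σ) {v : Space d → ℝ}
    (hv : Continuous v) :
    IsSolution P lam σ (evolutionCurve c a lam hσ hv 0) (evolutionCurve c a lam hσ hv) := by
  have hc := continuous_evolution c a lam hσ hv
  refine ⟨rfl, evolution c a lam σ v, hc.locallyIntegrable.locallyIntegrableOn _,
    ((continuous_nonlin hσ).comp hc).locallyIntegrable.locallyIntegrableOn _,
    .of_forall fun t ht => ⟨(hc.comp (by fun_prop)).locallyIntegrable, fun φ => ?_⟩,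
    evolution_equation hP lam hσ hv⟩
  rw [evolutionCurve_apply, Real.coe_toNNReal t ht.le]
  rfl

theorem eq_evolutionCurve_of_isSolution {P : Space d → ℝ} {c : Space d} {a : ℝ}
    (hP : ∀ ξ, P ξ = inner ℝ c ξ + a) {lam σ : ℝ} (hσ : 0 < σ) {v : Space d → ℝ}
    (hv : Continuous v) {w : C(ℝ≥0, Distr d)}
    (hw : IsSolution P lam σ (evolutionCurve c a lam hσ hv 0) w) :
    w = evolutionCurve c a lam hσ hv := by
  obtain ⟨hw0, U, hU, hUn, hUt, hUeq⟩ := hw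
  set V : ℝ × Space d → ℂ := fun p => wave (-a) p.1 * U ((shear c).symm p) with hV
  have hVl : LocallyIntegrableOn V (spaceTime d) := by
    rw [hV, shear_symm]
    exact locallyIntegrableOn_wave_mul (-a) (locallyIntegrableOn_comp_shear (-c) hU)
  have hVn : LocallyIntegrableOn (fun p => nonlin σ (V p)) (spaceTime d) := by
    have h1 := locallyIntegrableOn_wave_mul (-a) (locallyIntegrableOn_comp_shear (-c) hUn)
    simp_rw [hV, shear_symm, nonlin_mul_of_norm_one σ (norm_wave _ _)]
    exact h1
  have hGl : LocallyIntegrableOn (fun p => -Complex.I * lam * nonlin σ (V p)) (spaceTime d) := by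
    intro p hp
    obtain ⟨s, hs, hfs⟩ := hVn p hp
    exact ⟨s, hs, hfs.const_mul _⟩
  have hweak := ae_slice_weak hVl hGl fun η hη hηc hηs χ hχ hχc =>
    straightened_equation hP hUeq (fun _ => rfl) hVl hVn hη hηc hηs hχ hχc
  have hode : ∀ᵐ y : Space d, ∃ A : ℂ, ∀ᵐ t, 0 < t → V (t, y) = flow lam σ t A := by
    filter_upwards [hweak, ae_locallyIntegrableOn_slice hVl, ae_locallyIntegrableOn_slice hVn]
      with y h1 h2 h3
    exact exists_ae_eq_flow_of_weak_solution hσ h2 h3 h1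
  obtain ⟨A, hAm, hA⟩ := exists_profile hσ hVl hode
  set D : Set ℝ := {t | 0 < t → (LocallyIntegrable (fun x => U (t, x)) ∧
      ∀ φ : 𝓓((⊤ : Opens (Space d)), ℝ),
        w t.toNNReal φ = ∫ x, ((φ x : ℝ) : ℂ) * U (t, x)) ∧
      ∀ᵐ y : Space d, V (t, y) = flow lam σ t (A y)} with hD
  have hDd : Dense D := Measure.dense_of_ae (μ := (volume : Measure ℝ)) (by
    filter_upwards [hUt, hA] with t h1 h2 h0 using ⟨h1 h0, h2 h0⟩)
  -- Good positive times accumulate at every `t ≥ 0`, including `0`, where the initial condition is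
  -- to be read off.
  have hcl : Ici (0 : ℝ) ⊆ closure (Ioi 0 ∩ D) := by
    rw [← closure_Ioi]
    exact closure_minimal (hDd.open_subset_closure_inter isOpen_Ioi) isClosed_closure
  have hUV : ∀ t x, U (t, x) = wave a t * V (t, x + t • c) := by
    intro t x
    simp only [hV]
    rw [shear_symm_apply, add_sub_cancel_right, ← mul_assoc, mul_comm (wave a t),
      wave_neg_mul_wave, one_mul]
  have hpair : ∀ t ∈ Ioi (0 : ℝ) ∩ D, ∀ φ : 𝓓((⊤ : Opens (Space d)), ℝ),
      w t.toNNReal φ =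
        ∫ x, ((φ x : ℝ) : ℂ) * (wave a t * flow lam σ t (A (x + t • c))) := by
    rintro t ⟨ht0, ht⟩ φ
    obtain ⟨⟨-, h1⟩, h2⟩ := ht ht0
    rw [h1]
    refine integral_congr_ae ?_
    filter_upwards [(measurePreserving_add_right (volume : Measure (Space d))
      (t • c)).quasiMeasurePreserving.ae h2] with x hx
    rw [hUV, hx]
  -- One good time suffices: there `|A y| = |U (t, y - t c)|` almost everywhere.
  have hAl : LocallyIntegrable A := by
    obtain ⟨t, ht0, ht⟩ : (Ioi (0 : ℝ) ∩ D).Nonempty :=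
      closure_nonempty_iff.1 ⟨0, hcl self_mem_Ici⟩
    obtain ⟨⟨h1, -⟩, h2⟩ := ht ht0
    refine locallyIntegrable_iff.2 fun K hK => ?_
    have h3 : IntegrableOn (fun y => U (t, y + -(t • c))) K := by
      have h4 := h1.integrableOn_isCompact (hK.image (continuous_add_const (-(t • c))))
      have h5 := ((measurePreserving_add_right (volume : Measure (Space d))
        (-(t • c))).integrableOn_comp_preimage
        (Homeomorph.addRight (-(t • c))).measurableEmbedding).2 h4
      rwa [(add_left_injective _).preimage_image] at h5
    refine Integrable.mono h3 hAm.restrict (ae_restrict_of_ae ?_)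
    filter_upwards [h2] with y hy
    rw [hUV, norm_mul, norm_wave, one_mul, neg_add_cancel_right, hy, norm_flow]
  -- Along good times tending to `0` the pairing with a test function has two limits, one from the
  -- flow formula and one from continuity of `w` as a curve of distributions.
  have hAv : ∀ᵐ x, A x = v x := by
    refine ae_eq_of_integral_contDiff_smul_eq hAl
      (Complex.continuous_ofReal.comp hv).locallyIntegrable fun g hg hgc => ?_
    have hlim := tendsto_integral_flow (lam := lam) hσ c a hAl (toTest g hg hgc)
    have hsub : 𝓝[Ioi 0 ∩ D] (0 : ℝ) ≤ 𝓝[>] 0 := nhdsWithin_mono _ inter_subset_left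
    have : (𝓝[Ioi 0 ∩ D] (0 : ℝ)).NeBot := mem_closure_iff_nhdsWithin_neBot.1 (hcl self_mem_Ici)
    have h1 := (continuous_apply_toNNReal w (toTest g hg hgc)).tendsto 0
    rw [Real.toNNReal_zero, hw0, evolutionCurve_zero_apply] at h1
    have h2 : Tendsto (fun t : ℝ => w t.toNNReal (toTest g hg hgc)) (𝓝[Ioi 0 ∩ D] (0 : ℝ))
        (𝓝 (∫ x, ((toTest g hg hgc x : ℝ) : ℂ) * A x)) := by
      refine (hlim.mono_left hsub).congr' ?_
      filter_upwards [self_mem_nhdsWithin] with t ht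
      exact (hpair t ht _).symm
    have h3 := tendsto_nhds_unique h2 (h1.mono_left nhdsWithin_le_nhds)
    simp only [Complex.real_smul]
    exact h3
  have hev : ∀ φ : 𝓓((⊤ : Opens (Space d)), ℝ),
      EqOn (fun t : ℝ => w t.toNNReal φ) (fun t : ℝ => evolutionCurve c a lam hσ hv t.toNNReal φ)
        (closure (Ioi 0 ∩ D)) := by
    intro φ
    refine EqOn.closure (fun t ht => ?_) (continuous_apply_toNNReal _ φ)
      (continuous_apply_toNNReal _ φ)
    rw [hpair t ht, evolutionCurve_apply, Real.coe_toNNReal t (le_of_lt ht.1)]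
    refine integral_congr_ae ?_
    filter_upwards [(measurePreserving_add_right (volume : Measure (Space d))
      (t • c)).quasiMeasurePreserving.ae hAv] with x hx
    rw [hx]
  ext t φ
  have h1 := hev φ (hcl (mem_Ici.2 t.2))
  simpa using h1

/-! ### Ill-posedness -/

theorem exists_norm_inflation (hd : 1 ≤ d) {lam σ : ℝ} (hlam : lam ≠ 0) (hσ : 0 < σ)
    {P : Space d → ℝ} {c : Space d} {a : ℝ} (hP : ∀ ξ, P ξ = inner ℝ c ξ + a) {δ : ℝ}
    (hδ : 0 < δ) :
    ∃ u₀ : Distr d, MemH ((d : ℝ) / 2) u₀ ∧ normH ((d : ℝ) / 2) u₀ ≤ ENNReal.ofReal δ ∧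
      ∃ u : C(ℝ≥0, Distr d), IsSolution P lam σ u₀ u ∧
        (∀ w : C(ℝ≥0, Distr d), IsSolution P lam σ u₀ w → w = u) ∧
        ∀ t : ℝ≥0, 0 < t → ¬ MemH ((d : ℝ) / 2) (u t) := by
  obtain ⟨v, hv, -, ⟨F, hFδ, hF⟩, hvK⟩ := exists_initial_datum hd hσ hδ
  set T := TemperedDistribution.besselPotential (Space d) ℂ (-((d : ℝ) / 2))
    (F : 𝓢'(Space d, ℂ)) with hT
  have hTF : TemperedDistribution.besselPotential (Space d) ℂ ((d : ℝ) / 2) T =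
      (F : 𝓢'(Space d, ℂ)) :=
    (TemperedDistribution.besselPotential_neg_apply_eq_iff _ _ _).1 hT.symm
  have hres : RestrictsTo T (evolutionCurve c a lam hσ hv 0) := fun φ => by
    rw [evolutionCurve_zero_apply, hF]
  refine ⟨evolutionCurve c a lam hσ hv 0, ⟨T, hres, F, hTF⟩, ?_, evolutionCurve c a lam hσ hv,
    isSolution_evolutionCurve hP lam hσ hv,
    fun w hw => eq_evolutionCurve_of_isSolution hP hσ hv hw, fun t ht => ?_⟩
  · refine (iInf₂_le_of_le T hres (iInf₂_le_of_le F hTF ?_))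
    rw [← ofReal_norm]
    exact ENNReal.ofReal_le_ofReal hFδ
  · exact not_memH_flow hd hlam (NNReal.coe_pos.2 ht) hvK (norm_wave a t)
      (evolutionCurve_apply c a lam hσ hv t)


end ModifiedNLS

end

theorem proposition1 (d : ℕ) (hd : 1 ≤ d) (lam σ : ℝ) (hlam : lam ≠ 0) (hσ : 0 < σ)
    (hreg : (∃ n : ℕ, σ = n) ∨ ∃ r : ℕ, (r : ℝ) ≤ 2 * σ ∧ (d : ℝ) / 2 < r)
    (P : ModifiedNLS.Space d → ℝ)
    (hP : (∃ c : ModifiedNLS.Space d, ∀ ξ, P ξ = inner ℝ c ξ) ∨ ∃ c : ℝ, ∀ ξ, P ξ = c)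
    (δ : ℝ) (hδ : 0 < δ) :
    ∃ u₀ : ModifiedNLS.Distr d,
      ModifiedNLS.MemH ((d : ℝ) / 2) u₀ ∧
      ModifiedNLS.normH ((d : ℝ) / 2) u₀ ≤ ENNReal.ofReal δ ∧
      ∃ u : C(ℝ≥0, ModifiedNLS.Distr d),
        ModifiedNLS.IsSolution P lam σ u₀ u ∧
        (∀ w : C(ℝ≥0, ModifiedNLS.Distr d), ModifiedNLS.IsSolution P lam σ u₀ w → w = u) ∧
        ∀ t : ℝ≥0, 0 < t → ¬ ModifiedNLS.MemH ((d : ℝ) / 2) (u t) := by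
  rcases hP with ⟨c, hc⟩ | ⟨a, ha⟩
  · exact ModifiedNLS.exists_norm_inflation hd hlam hσ (c := c) (a := 0) (by simpa using hc) hδ
  · exact ModifiedNLS.exists_norm_inflation hd hlam hσ (c := 0) (a := a) (by simpa using ha) hδ
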